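/- Let $n\ge 1$ be an integer and let $\alpha\in\mathbb R$ satisfy $n-2\alpha>0$, $n+2\alpha>0$ and $n+2+4\alpha>0$. Let $H^2_{\alpha,-2-2\alpha}(\mathbb R^n)$ be the completion of the space $C_0^\infty(\mathbb R^n)$ of real-valued smooth compactly supported functions under the norm $$\|u\|=\Big(\int_{\mathbb R^n}|\Delta u|^2|x|^{-2\alpha}\,dx+\int_{\mathbb R^n}|\nabla u|^2|x|^{2+2\alpha}\,dx\Big)^{1/2},$$ regarded as a space of functions: $u\in L^1_{\rm loc}(\mathbb R^n)$ belongs to it if and only if $u$ is the limit in $L^1_{\rm loc}(\mathbb R^n)$ of a sequence in $C_0^\infty(\mathbb R^n)$ that is Cauchy for this norm. Then every $u\in H^2_{\alpha,-2-2\alpha}(\mathbb R^n)$ has a weak gradient $\nabla u$ and a weak Laplacian $\Delta u$, the three integrals below are finite, and $$\int_{\mathbb R^n}\frac{|\Delta u|^2}{|x|^{2\alpha}}\,dx\;\int_{\mathbb R^n}|x|^{2\alpha}|\nabla u\cdot x|^2\,dx\;\ge\;\Big(\frac{n+4\alpha+2}{2}\Big)^2\Big(\int_{\mathbb R^n}|\nabla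 u|^2\,dx\Big)^2 .$$ Furthermore, if $1+\alpha>0$, then the constant $\big(\frac{n+4\alpha+2}{2}\big)^2$ is sharp, that is, the inequality fails for some $u\in H^2_{\alpha,-2-2\alpha}(\mathbb R^n)$ if the constant is replaced by any larger one, and it is attained: the function $$U_0(x)=\exp\Big(-\frac{|x|^{2(1+\alpha)}}{2(1+\alpha)}\Big)$$ belongs to $H^2_{\alpha,-2-2\alpha}(\mathbb R^n)$, satisfies $\int_{\mathbb R^n}|\nabla U_0|^2\,dx>0$, and gives equality. -/

import Mathlib

open MeasureTheory Filter Topology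
open scoped ContDiff Gradient InnerProductSpace Laplacian

/-- `φ` belongs to `C_0^∞(ℝⁿ)`: smooth, real valued, with compact support. -/
def IsTestFunction {n : ℕ} (φ : EuclideanSpace ℝ (Fin n) → ℝ) : Prop :=
  ContDiff ℝ ∞ φ ∧ HasCompactSupport φ

/-- The norm `(∫ |Δφ|² |x|^{-2α} dx + ∫ |∇φ|² |x|^{-β} dx)^{1/2}` of a test function `φ`. When
`n - 2α > 0` and `n - β > 0` both integrands are integrable for every test function. -/
noncomputable def H2norm {n : ℕ} (α β : ℝ) (φ : EuclideanSpace ℝ (Fin n) → ℝ) : ℝ :=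
  Real.sqrt ((∫ x, (Laplacian.laplacian φ x) ^ 2 * ‖x‖ ^ (-2 * α)) +
    ∫ x, ‖gradient φ x‖ ^ 2 * ‖x‖ ^ (-β))

/-- `H²_{α,β}(ℝⁿ)`, the completion of `C_0^∞(ℝⁿ)` under `H2norm α β`, realised as a space of
functions: `u` is the limit in `L¹_loc` of a sequence of test functions that is Cauchy for this
norm. -/
def MemH2 {n : ℕ} (α β : ℝ) (u : EuclideanSpace ℝ (Fin n) → ℝ) : Prop :=
  LocallyIntegrable u volume ∧
  ∃ φ : ℕ → EuclideanSpace ℝ (Fin n) → ℝ,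
    (∀ k, IsTestFunction (φ k)) ∧
    (∀ ε > 0, ∃ N, ∀ j ≥ N, ∀ k ≥ N, H2norm α β (φ j - φ k) < ε) ∧
    (∀ K : Set (EuclideanSpace ℝ (Fin n)), IsCompact K →
      Tendsto (fun k => ∫ x in K, |φ k x - u x|) atTop (𝓝 0))

/-- `G` is (a version of) the weak gradient of `u`; it is unique up to null sets. -/
def IsWeakGradient {n : ℕ} (u : EuclideanSpace ℝ (Fin n) → ℝ)
    (G : EuclideanSpace ℝ (Fin n) → EuclideanSpace ℝ (Fin n)) : Prop :=
  LocallyIntegrable u volume ∧ LocallyIntegrable G volume ∧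
  ∀ φ : EuclideanSpace ℝ (Fin n) → ℝ, IsTestFunction φ → ∀ v : EuclideanSpace ℝ (Fin n),
    ∫ x, u x * inner ℝ (gradient φ x) v = -∫ x, inner ℝ (G x) v * φ x

/-- `L` is (a version of) the weak Laplacian of `u`; it is unique up to null sets. -/
def IsWeakLaplacian {n : ℕ} (u L : EuclideanSpace ℝ (Fin n) → ℝ) : Prop :=
  LocallyIntegrable u volume ∧ LocallyIntegrable L volume ∧
  ∀ φ : EuclideanSpace ℝ (Fin n) → ℝ, IsTestFunction φ →
    ∫ x, u x * Laplacian.laplacian φ x = ∫ x, L x * φ x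

/-- `U₀(x) = exp(-|x|^{2(1+α)} / (2(1+α)))`. -/
noncomputable def U₀ (n : ℕ) (α : ℝ) (x : EuclideanSpace ℝ (Fin n)) : ℝ :=
  Real.exp (-(‖x‖ ^ (2 * (1 + α)) / (2 * (1 + α))))

/-! ### Radial integrals -/

section Radial

variable {n : ℕ}

local notation "𝔼" => EuclideanSpace ℝ (Fin n)

/-! For a test function φ put D = ∫|∇φ|² and test Δφ against ψ = x·∇φ + (n+2α)φ. The Pohozaev
identity and Green's identity give ∫ Δφ ψ = ((n-2)/2 - (n+2α)) D = -((n+4α+2)/2) D. On the other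
hand ∫ ψ²|x|^{2α} = ∫ (x·∇φ)²|x|^{2α}, because the terms containing φ cancel. Cauchy–Schwarz with
the weights |x|^{-α} and |x|^{α} on the two factors is then the inequality for φ
(`IsTestFunction.caffarelli_kohn_nirenberg`). Both the Pohozaev identity and the cancellation rest
on the weighted divergence identity `integral_norm_rpow_mul_fderiv_self`.

In the completion, the inequality for test functions itself bounds the unweighted ∫|∇φ|² by the
square of the norm, since n+4α+2 > 0. A Cauchy sequence therefore has gradients converging in L²,
both with weight and without, and Laplacians converging in weighted L²
(`MemH2.exists_approximatedBy`). These limits are the weak derivatives, and all three integrals pass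
to the limit. Weak derivatives are unique almost everywhere, so the choice of version does not
matter.

The function U₀ satisfies ΔU₀ = -|x|^{2α}(x·∇U₀ + (n+2α)U₀), the equality case of Cauchy–Schwarz.
Equality is verified by expressing the three integrals through I(p) = ∫|x|^p U₀² and the recursion 2
I(p+2+2α) = (n+p) I(p). Membership of U₀ in the space is shown with the test functions obtained by
replacing |x|² by |x|²+ε in the profile and multiplying by a cutoff in ε|x|²; dominated convergence
as ε → 0 concludes (`approximatedBy_U₀`). -/

theorem nontrivial_euclideanSpace (hn : 1 ≤ n) : Nontrivial 𝔼 := by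
  have : Nonempty (Fin n) := ⟨⟨0, hn⟩⟩
  infer_instance

theorem pow_smul_rpow_mul_exp (hn : 1 ≤ n) (p q b : ℝ) {y : ℝ} (hy : 0 < y) :
    y ^ (Module.finrank ℝ 𝔼 - 1) • (y ^ p * Real.exp (-b * y ^ q)) =
      y ^ ((n : ℝ) - 1 + p) * Real.exp (-b * y ^ q) := by
  rw [finrank_euclideanSpace_fin, smul_eq_mul, ← mul_assoc, ← Real.rpow_natCast,
    ← Real.rpow_add hy, Nat.cast_sub hn, Nat.cast_one]

theorem integrable_norm_rpow_mul_exp (hn : 1 ≤ n) {p q b : ℝ} (hp : 0 < n + p) (hq : 0 < q)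
    (hb : 0 < b) : Integrable (fun x : 𝔼 => ‖x‖ ^ p * Real.exp (-b * ‖x‖ ^ q)) := by
  have := nontrivial_euclideanSpace hn
  refine (integrable_fun_norm_addHaar (volume : Measure 𝔼)
    (f := fun y => y ^ p * Real.exp (-b * y ^ q))).2 ?_
  refine (integrableOn_rpow_mul_exp_neg_mul_rpow (s := n - 1 + p) (by linarith) hq hb).congr_fun
    (fun y hy => ?_) measurableSet_Ioi
  exact (pow_smul_rpow_mul_exp hn p q b hy).symm

theorem integral_norm_rpow_mul_exp (hn : 1 ≤ n) {p q b : ℝ} (hp : 0 < n + p) (hq : 0 < q)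
    (hb : 0 < b) : ∫ x : 𝔼, ‖x‖ ^ p * Real.exp (-b * ‖x‖ ^ q) =
      n * volume.real (Metric.ball (0 : 𝔼) 1) *
        (b ^ (-(n + p) / q) * (1 / q) * Real.Gamma ((n + p) / q)) := by
  have := nontrivial_euclideanSpace hn
  rw [integral_fun_norm_addHaar (volume : Measure 𝔼) (fun y => y ^ p * Real.exp (-b * y ^ q)),
    setIntegral_congr_fun measurableSet_Ioi fun y hy => pow_smul_rpow_mul_exp hn p q b hy,
    integral_rpow_mul_exp_neg_mul_rpow hq (by linarith) hb, finrank_euclideanSpace_fin,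
    nsmul_eq_mul, smul_eq_mul, show (n : ℝ) - 1 + p + 1 = n + p by ring, ← mul_assoc]

theorem integral_norm_rpow_mul_exp_pos (hn : 1 ≤ n) {p q b : ℝ} (hp : 0 < n + p) (hq : 0 < q)
    (hb : 0 < b) : 0 < ∫ x : 𝔼, ‖x‖ ^ p * Real.exp (-b * ‖x‖ ^ q) := by
  rw [integral_norm_rpow_mul_exp hn hp hq hb]
  have h1 : 0 < volume.real (Metric.ball (0 : 𝔼) 1) :=
    ENNReal.toReal_pos (Metric.measure_ball_pos _ _ one_pos).ne' measure_ball_lt_top.ne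
  have h2 : 0 < Real.Gamma ((n + p) / q) := Real.Gamma_pos_of_pos (div_pos hp hq)
  have h3 : (0 : ℝ) < n := by exact_mod_cast hn
  positivity

/-- Integration by parts in the radial variable. -/
theorem integral_norm_rpow_add_mul_exp (hn : 1 ≤ n) {p q b : ℝ} (hp : 0 < n + p) (hq : 0 < q)
    (hb : 0 < b) : b * q * ∫ x : 𝔼, ‖x‖ ^ (p + q) * Real.exp (-b * ‖x‖ ^ q) =
      (n + p) * ∫ x : 𝔼, ‖x‖ ^ p * Real.exp (-b * ‖x‖ ^ q) := by
  rw [integral_norm_rpow_mul_exp hn hp hq hb,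
    integral_norm_rpow_mul_exp hn (p := p + q) (by linarith) hq hb,
    -- Raising p by q shifts the Gamma argument by one, so the identity is Γ(s+1) = sΓ(s).
    show (n + (p + q)) / q = (n + p) / q + 1 by field_simp; ring,
    show -(n + (p + q)) / q = -(n + p) / q - 1 by field_simp; ring,
    Real.Gamma_add_one (div_pos hp hq).ne', Real.rpow_sub_one hb.ne']
  field_simp

/-- Multiplying the globally integrable |x|^p e^{-|x|} by the continuous function e^{|x|} gives back
|x|^p. -/
theorem locallyIntegrable_norm_rpow (hn : 1 ≤ n) {p : ℝ} (hp : 0 < n + p) :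
    LocallyIntegrable (fun x : 𝔼 => ‖x‖ ^ p) := by
  have h := (integrable_norm_rpow_mul_exp hn hp one_pos one_pos).locallyIntegrable
  have hc : Continuous fun x : 𝔼 => Real.exp ‖x‖ := by fun_prop
  have := h.smul_continuous (g := fun x : 𝔼 => Real.exp ‖x‖) hc
  refine this.congr (ae_of_all _ fun x => ?_)
  simp [mul_assoc, ← Real.exp_add]

theorem integrable_mul_norm_rpow (hn : 1 ≤ n) {p : ℝ} (hp : 0 < n + p) {f : 𝔼 → ℝ}
    (hf : Continuous f) (hs : HasCompactSupport f) :
    Integrable fun x : 𝔼 => f x * ‖x‖ ^ p := by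
  simpa using (locallyIntegrable_norm_rpow hn hp).integrable_smul_left_of_hasCompactSupport hf hs

/-- The weighted divergence identity `∫ |x|^p x·∇w = -(n+p) ∫ |x|^p w`. -/
theorem integral_norm_rpow_mul_fderiv_self (hn : 1 ≤ n) {p : ℝ} (hp : 0 < n + p) {w : 𝔼 → ℝ}
    (hw : ContDiff ℝ 1 w) (hs : HasCompactSupport w) :
    ∫ x, fderiv ℝ w x x * ‖x‖ ^ p = -(n + p) * ∫ x, w x * ‖x‖ ^ p := by
  have hcd : Continuous (fderiv ℝ w) := hw.continuous_fderiv (by norm_num)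
  obtain ⟨M, hM⟩ := hcd.bounded_above_of_compact_support (hs.fderiv (𝕜 := ℝ))
  obtain ⟨R, hR⟩ := (hs.fderiv (𝕜 := ℝ)).isBounded.subset_closedBall 0
  have hM0 : 0 ≤ M := (norm_nonneg _).trans (hM 0)
  have hmeas : Measurable fun x : 𝔼 => ‖x‖ ^ p := by fun_prop
  -- The scaling law ∫ w(tx)|x|^p dx = t^{-(n+p)} ∫ w|x|^p is differentiated at t = 1 in two ways.
  -- This avoids integrating by parts across the origin, where |x|^p may be singular.
  have key : HasDerivAt (fun t : ℝ => ∫ x, w (t • x) * ‖x‖ ^ p)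
      (∫ x, fderiv ℝ w ((1 : ℝ) • x) x * ‖x‖ ^ p) 1 := by
    -- With t > 1/2, the condition |tx| ≤ R forces |x| ≤ 2R, so one ball contains all the supports
    -- and |x|^p is integrable on it.
    refine (hasDerivAt_integral_of_dominated_loc_of_deriv_le
      (F := fun t x => w (t • x) * ‖x‖ ^ p)
      (F' := fun t x => fderiv ℝ w (t • x) x * ‖x‖ ^ p)
      (bound := (Metric.closedBall (0 : 𝔼) (2 * R)).indicator fun x => M * (2 * R) * ‖x‖ ^ p)
      (Ioo_mem_nhds (show (1 / 2 : ℝ) < 1 by norm_num) (show (1 : ℝ) < 2 by norm_num))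
      (Eventually.of_forall fun t => ?_) ?_ ?_ ?_ ?_ ?_).2
    · exact ((hw.continuous.comp (continuous_const_smul t)).measurable.mul
        hmeas).aestronglyMeasurable
    · simpa using integrable_mul_norm_rpow hn hp hw.continuous hs
    · have : Continuous fun x : 𝔼 => fderiv ℝ w ((1 : ℝ) • x) x := by
        simpa using hcd.clm_apply continuous_id
      exact (this.measurable.mul hmeas).aestronglyMeasurable
    · refine ae_of_all _ fun x t ht => ?_
      by_cases hx : t • x ∈ tsupport (fderiv ℝ w)
      · have h1 : ‖t • x‖ ≤ R := by simpa using hR hx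
        rw [norm_smul, Real.norm_of_nonneg (by linarith [ht.1])] at h1
        have h2 : ‖x‖ ≤ 2 * R := by nlinarith [ht.1, norm_nonneg x]
        rw [Set.indicator_of_mem (by simpa using h2), norm_mul,
          Real.norm_of_nonneg (Real.rpow_nonneg (norm_nonneg x) p)]
        gcongr
        exact ((fderiv ℝ w (t • x)).le_opNorm x).trans (by gcongr; exact hM _)
      · rw [image_eq_zero_of_notMem_tsupport hx]
        simp only [zero_apply, zero_mul, norm_zero]
        refine Set.indicator_nonneg (fun y hy => ?_) x
        have : 0 ≤ 2 * R := (norm_nonneg y).trans (by simpa using hy)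
        positivity
    · rw [integrable_indicator_iff Metric.isClosed_closedBall.measurableSet]
      exact ((locallyIntegrable_norm_rpow hn hp).integrableOn_isCompact
        (isCompact_closedBall _ _)).const_mul _
    · refine ae_of_all _ fun x t _ => ?_
      have h1 : HasDerivAt (fun t : ℝ => t • x) x t := by
        simpa using (hasDerivAt_id t).smul_const x
      have h2 := ((hw.differentiable (by norm_num)) (t • x)).hasFDerivAt.comp_hasDerivAt t h1
      exact h2.mul_const _
  have key2 : HasDerivAt (fun t : ℝ => t ^ (-(n + p)) * ∫ x, w x * ‖x‖ ^ p)
      (-(n + p) * ∫ x, w x * ‖x‖ ^ p) 1 := by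
    simpa using (Real.hasDerivAt_rpow_const (x := 1) (p := -(n + p))
      (Or.inl one_ne_zero)).mul_const (∫ x, w x * ‖x‖ ^ p)
  have heq : (fun t : ℝ => ∫ x, w (t • x) * ‖x‖ ^ p) =ᶠ[𝓝 1]
      fun t : ℝ => t ^ (-(n + p)) * ∫ x, w x * ‖x‖ ^ p := by
    filter_upwards [lt_mem_nhds (show (0 : ℝ) < 1 by norm_num)] with t ht
    have h1 : ∀ x : 𝔼, w (t • x) * ‖x‖ ^ p = t ^ (-p) * (w (t • x) * ‖t • x‖ ^ p) := fun x => by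
      rw [norm_smul, Real.norm_of_nonneg ht.le, Real.mul_rpow ht.le (norm_nonneg x),
        Real.rpow_neg ht.le]
      have := (Real.rpow_pos_of_pos ht p).ne'
      field_simp
    simp_rw [h1]
    rw [integral_const_mul,
      Measure.integral_comp_smul_of_nonneg volume (fun x : 𝔼 => w x * ‖x‖ ^ p) t (hR := ht.le),
      finrank_euclideanSpace_fin, smul_eq_mul, ← mul_assoc, ← Real.rpow_natCast,
      ← Real.rpow_neg ht.le, ← Real.rpow_add ht]
    congr 2
    ring
  simpa using key.unique (key2.congr_of_eventuallyEq heq)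

end Radial

/-! ### The inequality for test functions -/

/-- The quadratic t ↦ ∫ (tg+f)² is nonnegative, so its discriminant is not positive. -/
theorem sq_integral_mul_le {X : Type*} [MeasurableSpace X] {μ : Measure X} {f g : X → ℝ}
    (hf : MemLp f 2 μ) (hg : MemLp g 2 μ) :
    (∫ x, f x * g x ∂μ) ^ 2 ≤ (∫ x, f x ^ 2 ∂μ) * ∫ x, g x ^ 2 ∂μ := by
  have hfg : Integrable (fun x => f x * g x) μ := hf.integrable_mul hg
  have h := discrim_le_zero (a := ∫ x, g x ^ 2 ∂μ) (b := 2 * ∫ x, f x * g x ∂μ)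
    (c := ∫ x, f x ^ 2 ∂μ) fun t => by
      have : 0 ≤ ∫ x, (t ^ 2 * g x ^ 2 + 2 * t * (f x * g x)) + f x ^ 2 ∂μ :=
        integral_nonneg fun x => by
          change 0 ≤ _
          nlinarith [sq_nonneg (t * g x + f x)]
      rw [integral_add ((hg.integrable_sq.const_mul _).fun_add (hfg.const_mul _)) hf.integrable_sq,
        integral_add (hg.integrable_sq.const_mul _) (hfg.const_mul _), integral_const_mul,
        integral_const_mul] at this
      linarith
  rw [discrim] at h
  linarith

section TestFunctions

variable {n : ℕ}

local notation "𝔼" => EuclideanSpace ℝ (Fin n)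

/-- The `i`-th partial derivative. -/
noncomputable def partialDeriv (i : Fin n) (f : 𝔼 → ℝ) (x : 𝔼) : ℝ :=
  fderiv ℝ f x (EuclideanSpace.single i 1)

theorem gradient_apply (f : 𝔼 → ℝ) (x : 𝔼) (i : Fin n) :
    gradient f x i = partialDeriv i f x := by
  rw [partialDeriv, ← inner_gradient_left, EuclideanSpace.inner_single_right]
  simp

theorem norm_sq_gradient (f : 𝔼 → ℝ) (x : 𝔼) :
    ‖gradient f x‖ ^ 2 = ∑ i, partialDeriv i f x ^ 2 := by
  rw [EuclideanSpace.norm_sq_eq]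
  simp [gradient_apply]

theorem fderiv_apply_eq_sum (f : 𝔼 → ℝ) (x v : 𝔼) :
    fderiv ℝ f x v = ∑ i, v i * partialDeriv i f x := by
  rw [← inner_gradient_left, PiLp.inner_apply]
  simp [gradient_apply]

theorem laplacian_eq_sum_partialDeriv {f : 𝔼 → ℝ} (hf : ContDiff ℝ 2 f) (x : 𝔼) :
    Laplacian.laplacian f x = ∑ i, partialDeriv i (partialDeriv i f) x := by
  rw [InnerProductSpace.laplacian_eq_iteratedFDeriv_orthonormalBasis f
    (EuclideanSpace.basisFun (Fin n) ℝ)]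
  refine Finset.sum_congr rfl fun i _ => ?_
  have hd : DifferentiableAt ℝ (fderiv ℝ f) x :=
    (hf.fderiv_right (m := 1) (by norm_num)).differentiable (by norm_num) x
  rw [iteratedFDeriv_two_apply]
  unfold partialDeriv
  rw [fderiv_clm_apply hd (differentiableAt_const _)]
  simp

theorem contDiff_partialDeriv {f : 𝔼 → ℝ} {k m : WithTop ℕ∞} (hf : ContDiff ℝ k f)
    (hk : m + 1 ≤ k) (i : Fin n) : ContDiff ℝ m (partialDeriv i f) :=
  (hf.fderiv_right hk).clm_apply contDiff_const

namespace IsTestFunction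

variable {φ ψ : EuclideanSpace ℝ (Fin n) → ℝ}

theorem partialDeriv (hφ : IsTestFunction φ) (i : Fin n) : IsTestFunction (partialDeriv i φ) :=
  ⟨contDiff_partialDeriv hφ.1 (by norm_num) i, hφ.2.fderiv_apply (𝕜 := ℝ) _⟩

theorem of_le (hφ : IsTestFunction φ) (k : ℕ) : ContDiff ℝ k φ := hφ.1.of_le (by exact_mod_cast le_top)

theorem continuous (hφ : IsTestFunction φ) : Continuous φ := hφ.1.continuous

theorem sub (hφ : IsTestFunction φ) (hψ : IsTestFunction ψ) : IsTestFunction (φ - ψ) :=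
  ⟨hφ.1.sub hψ.1, hφ.2.sub hψ.2⟩

theorem mul (hφ : IsTestFunction φ) (hψ : ContDiff ℝ ∞ ψ) :
    IsTestFunction fun x => φ x * ψ x :=
  ⟨hφ.1.mul hψ, hφ.2.mul_right⟩

theorem sum {ι : Type*} {s : Finset ι} {f : ι → EuclideanSpace ℝ (Fin n) → ℝ}
    (hf : ∀ i ∈ s, IsTestFunction (f i)) : IsTestFunction fun x => ∑ i ∈ s, f i x := by
  classical
  induction s using Finset.induction_on with
  | empty => exact ⟨by simpa using contDiff_const, HasCompactSupport.zero⟩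
  | insert a s ha ih =>
    simp only [Finset.sum_insert ha]
    have h1 := hf a (Finset.mem_insert_self _ _)
    have h2 := ih fun i hi => hf i (Finset.mem_insert_of_mem hi)
    exact ⟨h1.1.add h2.1, h1.2.add h2.2⟩

theorem integrable (hφ : IsTestFunction φ) : Integrable φ :=
  hφ.continuous.integrable_of_hasCompactSupport hφ.2

theorem laplacian_eq (hφ : IsTestFunction φ) :
    Laplacian.laplacian φ = fun x => ∑ i, _root_.partialDeriv i (_root_.partialDeriv i φ) x :=
  funext (laplacian_eq_sum_partialDeriv (hφ.of_le 2))

theorem laplacian (hφ : IsTestFunction φ) : IsTestFunction (Laplacian.laplacian φ) := by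
  rw [hφ.laplacian_eq]
  exact sum fun i _ => (hφ.partialDeriv i).partialDeriv i

theorem norm_sq_gradient (hφ : IsTestFunction φ) :
    IsTestFunction fun x => ‖gradient φ x‖ ^ 2 := by
  simp_rw [_root_.norm_sq_gradient, sq]
  exact sum fun i _ => (hφ.partialDeriv i).mul (hφ.partialDeriv i).1

theorem continuous_gradient (hφ : IsTestFunction φ) : Continuous (gradient φ) :=
  (InnerProductSpace.toDual ℝ _).symm.continuous.comp (hφ.1.continuous_fderiv (by simp))

theorem gradient_sub (hφ : IsTestFunction φ) (hψ : IsTestFunction ψ) (x : 𝔼) :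
    gradient (φ - ψ) x = gradient φ x - gradient ψ x := by
  simp only [gradient]
  rw [fderiv_sub (hφ.1.differentiable (by simp) x) (hψ.1.differentiable (by simp) x), map_sub]

theorem laplacian_sub (hφ : IsTestFunction φ) (hψ : IsTestFunction ψ) (x : 𝔼) :
    Laplacian.laplacian (φ - ψ) x = Laplacian.laplacian φ x - Laplacian.laplacian ψ x :=
  (hφ.of_le 2).contDiffAt.laplacian_sub (hψ.of_le 2).contDiffAt

theorem fderiv_self (hφ : IsTestFunction φ) : IsTestFunction fun x => fderiv ℝ φ x x := by
  simp_rw [fderiv_apply_eq_sum φ, mul_comm (_ : ℝ) (_root_.partialDeriv _ φ _)]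
  exact sum fun i _ => (hφ.partialDeriv i).mul (by fun_prop)

/-- Integration by parts against a smooth function. -/
theorem integral_partialDeriv_mul (hφ : IsTestFunction φ) (hψ : ContDiff ℝ ∞ ψ) (i : Fin n) :
    ∫ x, _root_.partialDeriv i φ x * ψ x = -∫ x, φ x * _root_.partialDeriv i ψ x := by
  have h1 := ((hφ.partialDeriv i).mul hψ).integrable
  have h2 := (hφ.mul (contDiff_partialDeriv hψ (m := ∞) (by norm_num) i)).integrable
  have h3 := (hφ.mul hψ).integrable
  rw [← neg_eq_iff_eq_neg, eq_comm]
  exact integral_mul_fderiv_eq_neg_fderiv_mul_of_integrable h1 h2 h3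
    (fun x _ => hφ.1.differentiable (by simp) x) (fun x _ => hψ.differentiable (by simp) x)

theorem integral_laplacian_mul (hφ : IsTestFunction φ) (hψ : ContDiff ℝ ∞ ψ) :
    ∫ x, Laplacian.laplacian φ x * ψ x =
      -∫ x, ∑ i, _root_.partialDeriv i φ x * _root_.partialDeriv i ψ x := by
  simp_rw [hφ.laplacian_eq, Finset.sum_mul]
  rw [integral_finsetSum _ fun i _ => (((hφ.partialDeriv i).partialDeriv i).mul hψ).integrable,
    integral_finsetSum _ fun i _ => ((hφ.partialDeriv i).mul
      (contDiff_partialDeriv hψ (m := ∞) (by norm_num) i)).integrable, ← Finset.sum_neg_distrib]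
  exact Finset.sum_congr rfl fun i _ => (hφ.partialDeriv i).integral_partialDeriv_mul hψ i

/-- Symmetry of the Hessian lets the derivative in direction x fall on ∂ᵢφ. -/
theorem partialDeriv_fderiv_self (hφ : IsTestFunction φ) (i : Fin n) (x : 𝔼) :
    _root_.partialDeriv i (fun x => fderiv ℝ φ x x) x =
      _root_.partialDeriv i φ x + fderiv ℝ (_root_.partialDeriv i φ) x x := by
  have hd : DifferentiableAt ℝ (fderiv ℝ φ) x :=
    ((hφ.of_le 2).fderiv_right (m := 1) (by norm_num)).differentiable (by norm_num) x
  have hsymm : IsSymmSndFDerivAt ℝ φ x := (hφ.of_le 2).contDiffAt.isSymmSndFDerivAt (by simp)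
  unfold _root_.partialDeriv
  rw [fderiv_clm_apply hd differentiableAt_fun_id, fderiv_clm_apply hd (differentiableAt_const _)]
  simpa using hsymm _ _

/-- The Pohozaev identity `∫ Δφ (x·∇φ) = (n-2)/2 ∫ |∇φ|²`. -/
theorem integral_laplacian_mul_fderiv_self (hn : 1 ≤ n) (hφ : IsTestFunction φ) :
    ∫ x, Laplacian.laplacian φ x * fderiv ℝ φ x x =
      ((n : ℝ) - 2) / 2 * ∫ x, ‖gradient φ x‖ ^ 2 := by
  have hw := hφ.norm_sq_gradient
  have h1 := integral_norm_rpow_mul_fderiv_self hn (p := 0)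
    (by simpa using (by exact_mod_cast hn : (0 : ℝ) < n)) (hw.of_le 1) hw.2
  simp only [Real.rpow_zero, mul_one, add_zero] at h1
  -- The second-order part Σ ∂ᵢφ (x·∇∂ᵢφ) is half of x·∇|∇φ|², which `h1` integrates to
  -- -(n/2)∫|∇φ|².
  have h2 : ∀ x, ∑ i, _root_.partialDeriv i φ x * _root_.partialDeriv i (fun x => fderiv ℝ φ x x) x
      = ‖gradient φ x‖ ^ 2 + 1 / 2 * fderiv ℝ (fun x => ‖gradient φ x‖ ^ 2) x x := fun x => by
    simp_rw [hφ.partialDeriv_fderiv_self, _root_.norm_sq_gradient]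
    have hd : ∀ i, DifferentiableAt ℝ (_root_.partialDeriv i φ) x :=
      fun i => (hφ.partialDeriv i).1.differentiable (by simp) x
    rw [fderiv_fun_sum fun i _ => (hd i).fun_pow 2, _root_.sum_apply, Finset.mul_sum,
      ← Finset.sum_add_distrib]
    refine Finset.sum_congr rfl fun i _ => ?_
    rw [fderiv_fun_pow 2 (hd i)]
    simp
    ring
  rw [hφ.integral_laplacian_mul hφ.fderiv_self.1]
  simp_rw [h2]
  rw [integral_add hw.integrable (hw.fderiv_self.integrable.const_mul _), integral_const_mul, h1]
  ring

theorem integral_laplacian_mul_self (hφ : IsTestFunction φ) :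
    ∫ x, Laplacian.laplacian φ x * φ x = -∫ x, ‖gradient φ x‖ ^ 2 := by
  rw [hφ.integral_laplacian_mul hφ.1]
  simp_rw [_root_.norm_sq_gradient, sq]

theorem integral_mul_laplacian_comm (hφ : IsTestFunction φ) (hψ : IsTestFunction ψ) :
    ∫ x, φ x * Laplacian.laplacian ψ x = ∫ x, Laplacian.laplacian φ x * ψ x := by
  simp_rw [mul_comm (φ _)]
  rw [hφ.integral_laplacian_mul hψ.1, hψ.integral_laplacian_mul hφ.1]
  simp_rw [mul_comm]

theorem integral_mul_fderiv (hφ : IsTestFunction φ) (hψ : IsTestFunction ψ) (v : 𝔼) :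
    ∫ x, φ x * inner ℝ (gradient ψ x) v = -∫ x, inner ℝ (gradient φ x) v * ψ x := by
  simp_rw [inner_gradient_left]
  have hf : ∀ {f : 𝔼 → ℝ}, IsTestFunction f → IsTestFunction fun x => fderiv ℝ f x v :=
    fun hf => ⟨(hf.1.fderiv_right (m := ∞) (by norm_num)).clm_apply contDiff_const,
      hf.2.fderiv_apply (𝕜 := ℝ) _⟩
  exact integral_mul_fderiv_eq_neg_fderiv_mul_of_integrable ((hf hφ).mul hψ.1).integrable
    (hφ.mul (hf hψ).1).integrable (hφ.mul hψ.1).integrable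
    (fun x _ => hφ.1.differentiable (by simp) x) (fun x _ => hψ.1.differentiable (by simp) x)

/-- Replacing `x·∇φ` by `x·∇φ + (n+2α)φ` does not change the weighted norm. -/
theorem integral_sq_fderiv_self_add (hn : 1 ≤ n) (hφ : IsTestFunction φ) {α : ℝ}
    (hα : 0 < n + 2 * α) :
    ∫ x, (fderiv ℝ φ x x + (n + 2 * α) * φ x) ^ 2 * ‖x‖ ^ (2 * α) =
      ∫ x, fderiv ℝ φ x x ^ 2 * ‖x‖ ^ (2 * α) := by
  have hsq : IsTestFunction fun x => φ x * φ x := hφ.mul hφ.1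
  have h1 := integral_norm_rpow_mul_fderiv_self hn hα (hsq.of_le 1) hsq.2
  have i1 := integrable_mul_norm_rpow hn hα hsq.continuous hsq.2
  have i2 := integrable_mul_norm_rpow hn hα hsq.fderiv_self.continuous hsq.fderiv_self.2
  have ht := hφ.fderiv_self.mul hφ.fderiv_self.1
  have i3 := integrable_mul_norm_rpow hn hα ht.continuous ht.2
  -- The cross term is (n+2α) x·∇(φ²), whose weighted integral is -(n+2α)²∫φ²|x|^{2α}. This cancels
  -- the last term exactly; n+2α is the only nonzero coefficient for which it does.
  have h2 : ∀ x, (fderiv ℝ φ x x + (n + 2 * α) * φ x) ^ 2 * ‖x‖ ^ (2 * α) =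
      fderiv ℝ φ x x * fderiv ℝ φ x x * ‖x‖ ^ (2 * α) +
      ((n + 2 * α) * (fderiv ℝ (fun x => φ x * φ x) x x * ‖x‖ ^ (2 * α)) +
        (n + 2 * α) ^ 2 * (φ x * φ x * ‖x‖ ^ (2 * α))) := fun x => by
    rw [fderiv_fun_mul (hφ.1.differentiable (by simp) x) (hφ.1.differentiable (by simp) x)]
    simp
    ring
  simp_rw [h2]
  rw [integral_add i3 ((i2.const_mul _).fun_add (i1.const_mul _)),
    integral_add (i2.const_mul _) (i1.const_mul _), integral_const_mul, integral_const_mul, h1]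
  simp_rw [← sq]
  ring

theorem integrable_sq_mul_norm_rpow (hn : 1 ≤ n) (hφ : IsTestFunction φ) {p : ℝ}
    (hp : 0 < n + p) : Integrable fun x => φ x ^ 2 * ‖x‖ ^ p := by
  have h := hφ.mul hφ.1
  simpa [sq] using integrable_mul_norm_rpow hn hp h.continuous h.2

theorem memLp_mul_norm_rpow (hn : 1 ≤ n) (hφ : IsTestFunction φ) {p : ℝ}
    (hp : 0 < n + 2 * p) : MemLp (fun x => φ x * ‖x‖ ^ p) 2 := by
  have hm : AEStronglyMeasurable (fun x : 𝔼 => φ x * ‖x‖ ^ p) :=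
    (hφ.continuous.measurable.mul (by fun_prop)).aestronglyMeasurable
  rw [memLp_two_iff_integrable_sq hm]
  refine (hφ.integrable_sq_mul_norm_rpow hn hp).congr (ae_of_all _ fun x => ?_)
  simp only [mul_pow]
  rw [← Real.rpow_mul_natCast (norm_nonneg x)]
  ring_nf

/-- Cauchy–Schwarz for |x|^{-α}Δφ and |x|^{α}(x·∇φ + (n+2α)φ). The added multiple of φ leaves the
norm of the second factor unchanged and produces the constant. -/
theorem caffarelli_kohn_nirenberg (hn : 1 ≤ n) (hφ : IsTestFunction φ) {α : ℝ}
    (h₁ : 0 < (n : ℝ) - 2 * α) (h₂ : 0 < (n : ℝ) + 2 * α) :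
    (((n : ℝ) + 4 * α + 2) / 2) ^ 2 * (∫ x, ‖gradient φ x‖ ^ 2) ^ 2 ≤
      (∫ x, Laplacian.laplacian φ x ^ 2 * ‖x‖ ^ (-2 * α)) *
        ∫ x, fderiv ℝ φ x x ^ 2 * ‖x‖ ^ (2 * α) := by
  have hψ : IsTestFunction fun x => fderiv ℝ φ x x + (n + 2 * α) * φ x :=
    ⟨hφ.fderiv_self.1.add (contDiff_const.mul hφ.1), hφ.fderiv_self.2.add hφ.2.mul_left⟩
  have hcs := sq_integral_mul_le (hφ.laplacian.memLp_mul_norm_rpow hn (p := -α) (by linarith))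
    (hψ.memLp_mul_norm_rpow hn (p := α) h₂)
  have hnt := nontrivial_euclideanSpace hn
  have e1 : ∀ x : 𝔼, ∀ a p : ℝ, (a * ‖x‖ ^ p) ^ 2 = a ^ 2 * ‖x‖ ^ (2 * p) := fun x a p => by
    rw [mul_pow, ← Real.rpow_mul_natCast (norm_nonneg x)]
    ring_nf
  have hlhs : ∫ x, (Laplacian.laplacian φ x * ‖x‖ ^ (-α)) *
      ((fderiv ℝ φ x x + (n + 2 * α) * φ x) * ‖x‖ ^ α) =
      -(((n : ℝ) + 4 * α + 2) / 2) * ∫ x, ‖gradient φ x‖ ^ 2 := by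
    have h0 : ∀ᵐ x : 𝔼, x ≠ 0 := by simp [ae_iff]
    have : ∫ x, (Laplacian.laplacian φ x * ‖x‖ ^ (-α)) *
        ((fderiv ℝ φ x x + (n + 2 * α) * φ x) * ‖x‖ ^ α) =
        ∫ x, Laplacian.laplacian φ x * fderiv ℝ φ x x +
          (n + 2 * α) * (Laplacian.laplacian φ x * φ x) := by
      refine integral_congr_ae (h0.mono fun x hx => ?_)
      have hx' : 0 < ‖x‖ := norm_pos_iff.2 hx
      have := (Real.rpow_pos_of_pos hx' α).ne'
      simp only [Real.rpow_neg hx'.le]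
      field_simp
    rw [this, integral_add (hφ.laplacian.mul hφ.fderiv_self.1).integrable
      ((hφ.laplacian.mul hφ.1).integrable.const_mul _), integral_const_mul,
      hφ.integral_laplacian_mul_fderiv_self hn, hφ.integral_laplacian_mul_self]
    ring
  rw [hlhs] at hcs
  simp_rw [e1] at hcs
  rw [hφ.integral_sq_fderiv_self_add hn h₂] at hcs
  simp_rw [show (2 : ℝ) * -α = -2 * α by ring] at hcs
  linarith

end IsTestFunction

end TestFunctions

/-! ### Convergence in `L²` -/

section SquareIntegrable

variable {X F : Type*} [MeasurableSpace X] {μ : Measure X} [NormedAddCommGroup F]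
  [InnerProductSpace ℝ F]

theorem norm_toLp_sq {f : X → F} (hf : MemLp f 2 μ) :
    ‖hf.toLp f‖ ^ 2 = ∫ x, ‖f x‖ ^ 2 ∂μ := by
  rw [← real_inner_self_eq_norm_sq, L2.inner_def]
  refine integral_congr_ae (hf.coeFn_toLp.mono fun x hx => ?_)
  simp [hx]

theorem norm_toLp_sub_sq {f g : X → F} (hf : MemLp f 2 μ) (hg : MemLp g 2 μ) :
    ‖hf.toLp f - hg.toLp g‖ ^ 2 = ∫ x, ‖f x - g x‖ ^ 2 ∂μ := by
  rw [← MemLp.toLp_sub, norm_toLp_sq]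
  simp

theorem tendsto_toLp_iff {f : ℕ → X → F} {g : X → F} (hf : ∀ k, MemLp (f k) 2 μ)
    (hg : MemLp g 2 μ) : Tendsto (fun k => (hf k).toLp (f k)) atTop (𝓝 (hg.toLp g)) ↔
      Tendsto (fun k => ∫ x, ‖f k x - g x‖ ^ 2 ∂μ) atTop (𝓝 0) := by
  rw [tendsto_iff_norm_sub_tendsto_zero]
  simp_rw [← norm_toLp_sub_sq (hf _) hg]
  refine ⟨fun h => by simpa using h.pow 2, fun h => ?_⟩
  simpa using h.sqrt

theorem cauchySeq_toLp_iff {f : ℕ → X → F} (hf : ∀ k, MemLp (f k) 2 μ) :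
    CauchySeq (fun k => (hf k).toLp (f k)) ↔
      ∀ ε > 0, ∃ N, ∀ j ≥ N, ∀ k ≥ N, ∫ x, ‖f j x - f k x‖ ^ 2 ∂μ < ε := by
  simp_rw [← norm_toLp_sub_sq (hf _) (hf _), Metric.cauchySeq_iff, dist_eq_norm]
  constructor
  · intro h ε hε
    obtain ⟨N, hN⟩ := h √ε (Real.sqrt_pos.2 hε)
    exact ⟨N, fun j hj k hk => (Real.lt_sqrt (norm_nonneg _)).1 (hN j hj k hk)⟩
  · intro h ε hε
    obtain ⟨N, hN⟩ := h (ε ^ 2) (by positivity)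
    exact ⟨N, fun j hj k hk => lt_of_pow_lt_pow_left₀ 2 hε.le (hN j hj k hk)⟩

theorem exists_memLp_two_limit [CompleteSpace F] {f : ℕ → X → F} (hf : ∀ k, MemLp (f k) 2 μ)
    (h : ∀ ε > 0, ∃ N, ∀ j ≥ N, ∀ k ≥ N, ∫ x, ‖f j x - f k x‖ ^ 2 ∂μ < ε) :
    ∃ g, MemLp g 2 μ ∧ Tendsto (fun k => ∫ x, ‖f k x - g x‖ ^ 2 ∂μ) atTop (𝓝 0) := by
  obtain ⟨g, hg⟩ := cauchySeq_tendsto_of_complete ((cauchySeq_toLp_iff hf).2 h)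
  refine ⟨g, Lp.memLp g, (tendsto_toLp_iff hf (Lp.memLp g)).1 ?_⟩
  rwa [Lp.toLp_coeFn]

theorem tendsto_integral_norm_sq {f : ℕ → X → F} {g : X → F} (hf : ∀ k, MemLp (f k) 2 μ)
    (hg : MemLp g 2 μ) (h : Tendsto (fun k => ∫ x, ‖f k x - g x‖ ^ 2 ∂μ) atTop (𝓝 0)) :
    Tendsto (fun k => ∫ x, ‖f k x‖ ^ 2 ∂μ) atTop (𝓝 (∫ x, ‖g x‖ ^ 2 ∂μ)) := by
  simpa only [norm_toLp_sq] using ((tendsto_toLp_iff hf hg).2 h).norm.pow 2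

theorem exists_integral_norm_sub_sq_lt {f : ℕ → X → F} {g : X → F} (hf : ∀ k, MemLp (f k) 2 μ)
    (hg : MemLp g 2 μ) (h : Tendsto (fun k => ∫ x, ‖f k x - g x‖ ^ 2 ∂μ) atTop (𝓝 0)) :
    ∀ ε > 0, ∃ N, ∀ j ≥ N, ∀ k ≥ N, ∫ x, ‖f j x - f k x‖ ^ 2 ∂μ < ε :=
  (cauchySeq_toLp_iff hf).1 ((tendsto_toLp_iff hf hg).2 h).cauchySeq

theorem tendsto_integral_of_norm_le {f g : ℕ → X → ℝ} (h0 : ∀ k x, 0 ≤ f k x)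
    (hfg : ∀ k x, f k x ≤ g k x) (hg : ∀ k, Integrable (g k) μ)
    (h : Tendsto (fun k => ∫ x, g k x ∂μ) atTop (𝓝 0)) :
    Tendsto (fun k => ∫ x, f k x ∂μ) atTop (𝓝 0) :=
  squeeze_zero (fun k => integral_nonneg (h0 k))
    (fun k => integral_mono_of_nonneg (ae_of_all _ (h0 k)) (hg k) (ae_of_all _ (hfg k))) h

end SquareIntegrable

/-! ### Weak derivatives of elements of the completion -/

section Completion

variable {n : ℕ}

local notation "𝔼" => EuclideanSpace ℝ (Fin n)

theorem ae_norm_pos (hn : 1 ≤ n) : ∀ᵐ x : 𝔼, 0 < ‖x‖ := by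
  have := nontrivial_euclideanSpace hn
  have h0 : ∀ᵐ x : 𝔼, x ≠ 0 := by simp [ae_iff]
  exact h0.mono fun x => norm_pos_iff.2

theorem norm_rpow_smul_sq {F : Type*} [NormedAddCommGroup F] [NormedSpace ℝ F] (x : 𝔼) (p : ℝ)
    (v : F) : ‖‖x‖ ^ p • v‖ ^ 2 = ‖v‖ ^ 2 * ‖x‖ ^ (2 * p) := by
  rw [norm_smul, Real.norm_of_nonneg (Real.rpow_nonneg (norm_nonneg x) p), mul_pow,
    ← Real.rpow_mul_natCast (norm_nonneg x)]
  ring_nf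

theorem norm_rpow_mul_sq (x : 𝔼) (p a : ℝ) :
    ‖‖x‖ ^ p * a‖ ^ 2 = a ^ 2 * ‖x‖ ^ (2 * p) := by
  rw [← smul_eq_mul, norm_rpow_smul_sq, Real.norm_eq_abs, sq_abs]

/-- A function that is square integrable with weight `|x|^{2p}`, `2p < n`, is locally
integrable. -/
theorem integrableOn_of_memLp_norm_rpow_smul {F : Type*} [NormedAddCommGroup F]
    [InnerProductSpace ℝ F] (hn : 1 ≤ n) {p : ℝ} (hp : 0 < n - 2 * p) {h : 𝔼 → F}
    (hh : MemLp (fun x => ‖x‖ ^ p • h x) 2) {K : Set 𝔼} (hK : IsCompact K) :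
    IntegrableOn h K ∧ (∫ x in K, ‖h x‖) ^ 2 ≤
      (∫ x in K, ‖x‖ ^ (-(2 * p))) * ∫ x, ‖‖x‖ ^ p • h x‖ ^ 2 := by
  have hloc := (locallyIntegrable_norm_rpow hn (p := -(2 * p)) (by linarith)).integrableOn_isCompact
    hK
  have hm1 : Measurable fun x : 𝔼 => ‖x‖ ^ (-p) := by fun_prop
  have e1 : ∀ x : 𝔼, (‖x‖ ^ (-p)) ^ 2 = ‖x‖ ^ (-(2 * p)) := fun x => by
    rw [← Real.rpow_mul_natCast (norm_nonneg x)]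
    ring_nf
  have e2 : ∀ᵐ x : 𝔼, ‖x‖ ^ (-p) • ‖x‖ ^ p • h x = h x := (ae_norm_pos hn).mono fun x hx => by
    rw [smul_smul, ← Real.rpow_add hx]
    simp
  have hm : AEStronglyMeasurable h volume :=
    (hm1.aestronglyMeasurable.smul hh.1).congr e2
  have hw : MemLp (fun x : 𝔼 => ‖x‖ ^ (-p)) 2 (volume.restrict K) := by
    rw [memLp_two_iff_integrable_sq hm1.aestronglyMeasurable]
    simp_rw [e1]
    exact hloc
  have hh' : MemLp (fun x => ‖‖x‖ ^ p • h x‖) 2 (volume.restrict K) := hh.norm.restrict K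
  have e3 : (fun x => ‖x‖ ^ (-p) * ‖‖x‖ ^ p • h x‖) =ᵐ[volume.restrict K] fun x => ‖h x‖ := by
    refine ae_restrict_of_ae ((ae_norm_pos hn).mono fun x hx => ?_)
    simp only [norm_smul, Real.norm_of_nonneg (Real.rpow_nonneg hx.le p)]
    rw [← mul_assoc, ← Real.rpow_add hx]
    simp
  refine ⟨(integrable_norm_iff hm.restrict).1 ((hw.integrable_mul hh').congr e3), ?_⟩
  have hcs := sq_integral_mul_le hw hh'
  rw [integral_congr_ae e3] at hcs
  simp_rw [e1] at hcs
  refine hcs.trans (mul_le_mul_of_nonneg_left ?_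
    (integral_nonneg fun x => Real.rpow_nonneg (norm_nonneg x) _))
  exact setIntegral_le_integral hh.norm.integrable_sq (ae_of_all _ fun x => sq_nonneg _)

/-- The preceding Cauchy–Schwarz bound, applied to the difference, turns weighted L² convergence
into convergence in L¹ on compact sets. -/
theorem tendsto_setIntegral_norm_sub {F : Type*} [NormedAddCommGroup F]
    [InnerProductSpace ℝ F] (hn : 1 ≤ n) {p : ℝ} (hp : 0 < n - 2 * p) {f : ℕ → 𝔼 → F} {g : 𝔼 → F}
    (hf : ∀ k, MemLp (fun x => ‖x‖ ^ p • f k x) 2) (hg : MemLp (fun x => ‖x‖ ^ p • g x) 2)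
    (h : Tendsto (fun k => ∫ x, ‖‖x‖ ^ p • (f k x - g x)‖ ^ 2) atTop (𝓝 0)) {K : Set 𝔼}
    (hK : IsCompact K) : Tendsto (fun k => ∫ x in K, ‖f k x - g x‖) atTop (𝓝 0) := by
  have h1 : ∀ k, (∫ x in K, ‖f k x - g x‖) ^ 2 ≤ (∫ x in K, ‖x‖ ^ (-(2 * p))) *
      ∫ x, ‖‖x‖ ^ p • (f k x - g x)‖ ^ 2 := fun k => by
    refine (integrableOn_of_memLp_norm_rpow_smul hn hp (h := fun x => f k x - g x) ?_ hK).2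
    simp only [smul_sub]
    exact (hf k).sub hg
  have h2 : Tendsto (fun k => (∫ x in K, ‖f k x - g x‖) ^ 2) atTop (𝓝 0) :=
    squeeze_zero (fun k => sq_nonneg _) h1 (by simpa using h.const_mul _)
  have h3 := h2.sqrt
  rw [Real.sqrt_zero] at h3
  exact h3.congr fun k => Real.sqrt_sq (integral_nonneg fun x => norm_nonneg _)

/-- Convergence in `L¹_loc` implies convergence of the integrals against a continuous compactly
supported function. -/
theorem tendsto_integral_mul_of_tendsto_setIntegral {f : ℕ → 𝔼 → ℝ} {g ψ : 𝔼 → ℝ}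
    (hf : ∀ k, LocallyIntegrable (f k)) (hg : LocallyIntegrable g) (hψ : Continuous ψ)
    (hs : HasCompactSupport ψ)
    (h : ∀ K : Set 𝔼, IsCompact K → Tendsto (fun k => ∫ x in K, ‖f k x - g x‖) atTop (𝓝 0)) :
    Tendsto (fun k => ∫ x, f k x * ψ x) atTop (𝓝 (∫ x, g x * ψ x)) := by
  obtain ⟨M, hM⟩ := hψ.bounded_above_of_compact_support hs
  have hi : ∀ {f : 𝔼 → ℝ}, LocallyIntegrable f → Integrable fun x => f x * ψ x := fun hf => by
    simpa [mul_comm] using hf.integrable_smul_left_of_hasCompactSupport hψ hs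
  rw [tendsto_iff_norm_sub_tendsto_zero]
  refine squeeze_zero (fun k => norm_nonneg _) (fun k => ?_)
    (by simpa using (h _ hs).const_mul M)
  rw [← integral_sub (hi (hf k)) (hi hg)]
  have hsupp : ∀ x, x ∉ tsupport ψ → f k x * ψ x - g x * ψ x = 0 := fun x hx => by
    simp [image_eq_zero_of_notMem_tsupport hx]
  rw [← setIntegral_eq_integral_of_forall_compl_eq_zero hsupp, ← integral_const_mul]
  refine norm_integral_le_of_norm_le ((((hf k).sub hg).integrableOn_isCompact
    hs).norm.const_mul M) (ae_of_all _ fun x => ?_)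
  rw [← sub_mul, norm_mul, mul_comm]
  exact mul_le_mul_of_nonneg_right (hM x) (norm_nonneg _)

/-- `φ` approximates `u`, `∇φ` approximates `G` and `Δφ` approximates `L`, in the norms that
control the second order Caffarelli-Kohn-Nirenberg inequality. -/
structure ApproximatedBy (α : ℝ) (u : EuclideanSpace ℝ (Fin n) → ℝ)
    (G : EuclideanSpace ℝ (Fin n) → EuclideanSpace ℝ (Fin n))
    (L : EuclideanSpace ℝ (Fin n) → ℝ) (φ : ℕ → EuclideanSpace ℝ (Fin n) → ℝ) : Prop where
  locallyIntegrable : LocallyIntegrable u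
  test : ∀ k, IsTestFunction (φ k)
  tendsto_loc : ∀ K : Set (EuclideanSpace ℝ (Fin n)), IsCompact K →
    Tendsto (fun k => ∫ x in K, |φ k x - u x|) atTop (𝓝 0)
  memLp_grad : MemLp G 2
  memLp_weighted_grad : MemLp (fun x => ‖x‖ ^ (1 + α) • G x) 2
  memLp_laplacian : MemLp (fun x => ‖x‖ ^ (-α) • L x) 2
  tendsto_grad : Tendsto (fun k => ∫ x, ‖gradient (φ k) x - G x‖ ^ 2) atTop (𝓝 0)
  tendsto_weighted_grad :
    Tendsto (fun k => ∫ x, ‖‖x‖ ^ (1 + α) • (gradient (φ k) x - G x)‖ ^ 2) atTop (𝓝 0)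
  tendsto_laplacian :
    Tendsto (fun k => ∫ x, ‖‖x‖ ^ (-α) • (Laplacian.laplacian (φ k) x - L x)‖ ^ 2) atTop (𝓝 0)

namespace IsTestFunction

variable {φ : EuclideanSpace ℝ (Fin n) → ℝ}

theorem memLp_norm_rpow_smul_laplacian (hn : 1 ≤ n) (hφ : IsTestFunction φ) {p : ℝ}
    (hp : 0 < n + 2 * p) : MemLp (fun x => ‖x‖ ^ p • Laplacian.laplacian φ x) 2 := by
  simpa [mul_comm] using hφ.laplacian.memLp_mul_norm_rpow hn hp

theorem memLp_norm_rpow_smul_gradient (hn : 1 ≤ n) (hφ : IsTestFunction φ) {p : ℝ}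
    (hp : 0 < n + 2 * p) : MemLp (fun x => ‖x‖ ^ p • gradient φ x) 2 := by
  have hm : AEStronglyMeasurable (fun x : 𝔼 => ‖x‖ ^ p • gradient φ x) :=
    AEStronglyMeasurable.smul (by fun_prop : Measurable fun x : 𝔼 => ‖x‖ ^ p).aestronglyMeasurable
      hφ.continuous_gradient.aestronglyMeasurable
  rw [memLp_two_iff_integrable_sq_norm hm]
  simp_rw [norm_rpow_smul_sq]
  exact integrable_mul_norm_rpow hn hp hφ.norm_sq_gradient.continuous hφ.norm_sq_gradient.2

theorem memLp_gradient (hn : 1 ≤ n) (hφ : IsTestFunction φ) : MemLp (gradient φ) 2 := by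
  simpa using hφ.memLp_norm_rpow_smul_gradient hn (p := 0) (by simp; omega)

theorem H2norm_sq (φ : 𝔼 → ℝ) (α : ℝ) :
    H2norm α (-2 - 2 * α) φ ^ 2 = (∫ x, ‖‖x‖ ^ (-α) • Laplacian.laplacian φ x‖ ^ 2) +
      ∫ x, ‖‖x‖ ^ (1 + α) • gradient φ x‖ ^ 2 := by
  rw [H2norm, Real.sq_sqrt]
  · simp_rw [norm_rpow_smul_sq, Real.norm_eq_abs, sq_abs, show 2 * -α = -2 * α by ring,
      show 2 * (1 + α) = -(-2 - 2 * α) by ring]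
  · exact add_nonneg (integral_nonneg fun x => by positivity)
      (integral_nonneg fun x => by positivity)

/-- The unweighted gradient is controlled by the norm of the completion. -/
theorem integral_norm_sq_gradient_le (hn : 1 ≤ n) (hφ : IsTestFunction φ) {α : ℝ}
    (h₁ : 0 < (n : ℝ) - 2 * α) (h₂ : 0 < (n : ℝ) + 2 * α) :
    ((n : ℝ) + 4 * α + 2) / 2 * (∫ x, ‖gradient φ x‖ ^ 2) ≤ H2norm α (-2 - 2 * α) φ ^ 2 := by
  have h := hφ.caffarelli_kohn_nirenberg hn h₁ h₂
  have hB : ∫ x, fderiv ℝ φ x x ^ 2 * ‖x‖ ^ (2 * α) ≤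
      ∫ x, ‖‖x‖ ^ (1 + α) • gradient φ x‖ ^ 2 := by
    refine integral_mono_ae (hφ.fderiv_self.integrable_sq_mul_norm_rpow hn h₂)
      (hφ.memLp_norm_rpow_smul_gradient hn (by linarith)).norm.integrable_sq
      ((ae_norm_pos hn).mono fun x hx => ?_)
    beta_reduce
    rw [norm_rpow_smul_sq, mul_add, mul_one, Real.rpow_add hx, Real.rpow_two, ← mul_assoc,
      ← mul_pow, ← inner_gradient_left]
    gcongr ?_ * _
    exact sq_le_sq.2 ((abs_real_inner_le_norm _ _).trans (le_abs_self _))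
  have hA : ∫ x, Laplacian.laplacian φ x ^ 2 * ‖x‖ ^ (-2 * α) =
      ∫ x, ‖‖x‖ ^ (-α) • Laplacian.laplacian φ x‖ ^ 2 := by
    simp_rw [norm_rpow_smul_sq, Real.norm_eq_abs, sq_abs, show 2 * -α = -2 * α by ring]
  rw [hA] at h
  rw [H2norm_sq]
  set A := ∫ x, ‖‖x‖ ^ (-α) • Laplacian.laplacian φ x‖ ^ 2
  set B := ∫ x, ‖‖x‖ ^ (1 + α) • gradient φ x‖ ^ 2
  have hA0 : 0 ≤ A := integral_nonneg fun x => by positivity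
  have hB0 : 0 ≤ B := integral_nonneg fun x => by positivity
  -- With C = (n+4α+2)/2 and D = ∫|∇φ|², the chain is (CD)² ≤ AB ≤ (A+B)²; the first bound uses
  -- |x·∇φ| ≤ |x||∇φ|.
  refine le_of_sq_le_sq ?_ (add_nonneg hA0 hB0)
  nlinarith [mul_le_mul_of_nonneg_left hB hA0, mul_nonneg hA0 hB0]

end IsTestFunction

/-- The hypothesis n+2+4α > 0 makes the constant positive, so the bound above controls the
unweighted gradient. Completeness of L² then supplies the limits. -/
theorem MemH2.exists_approximatedBy (hn : 1 ≤ n) {α : ℝ} (h₁ : 0 < (n : ℝ) - 2 * α)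
    (h₂ : 0 < (n : ℝ) + 2 * α) (h₃ : 0 < (n : ℝ) + 2 + 4 * α) {u : 𝔼 → ℝ}
    (hu : MemH2 α (-2 - 2 * α) u) : ∃ G L φ, ApproximatedBy α u G L φ := by
  obtain ⟨hloc, φ, hφ, hc, hK⟩ := hu
  have hc' : ∀ ε > 0, ∃ N, ∀ j ≥ N, ∀ k ≥ N, H2norm α (-2 - 2 * α) (φ j - φ k) ^ 2 < ε := by
    intro ε hε
    obtain ⟨N, hN⟩ := hc √ε (Real.sqrt_pos.2 hε)
    exact ⟨N, fun j hj k hk => (Real.lt_sqrt (Real.sqrt_nonneg _)).1 (hN j hj k hk)⟩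
  -- the Laplacians
  have mL : ∀ k, MemLp (fun x => ‖x‖ ^ (-α) • Laplacian.laplacian (φ k) x) 2 :=
    fun k => (hφ k).memLp_norm_rpow_smul_laplacian hn (by linarith)
  obtain ⟨l, hl, hlt⟩ := exists_memLp_two_limit mL fun ε hε => by
    obtain ⟨N, hN⟩ := hc' ε hε
    refine ⟨N, fun j hj k hk => lt_of_le_of_lt ?_ (hN j hj k hk)⟩
    rw [IsTestFunction.H2norm_sq]
    simp_rw [(hφ j).laplacian_sub (hφ k), smul_sub]
    exact le_add_of_nonneg_right (integral_nonneg fun x => by positivity)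
  -- the gradients
  let w : 𝔼 → ℝ := fun x => √(1 + ‖x‖ ^ (2 * (1 + α)))
  have hw0 : ∀ x : 𝔼, 0 ≤ ‖x‖ ^ (2 * (1 + α)) := fun x => by positivity
  have hw : ∀ x, 1 ≤ w x := fun x => Real.one_le_sqrt.2 (by linarith [hw0 x])
  have hwm : Measurable w := by fun_prop
  -- A single weight w carries the unweighted and the weighted norm together, so one limit in L²
  -- serves both; since w ≥ 1 it can be divided out everywhere.
  have hwsq : ∀ (x v : 𝔼), ‖w x • v‖ ^ 2 = ‖v‖ ^ 2 + ‖‖x‖ ^ (1 + α) • v‖ ^ 2 := fun x v => by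
    rw [norm_rpow_smul_sq, norm_smul, mul_pow, Real.norm_eq_abs, sq_abs,
      Real.sq_sqrt (by linarith [hw0 x])]
    ring
  have iG : ∀ {ψ : 𝔼 → ℝ}, IsTestFunction ψ → Integrable fun x => ‖gradient ψ x‖ ^ 2 :=
    fun h => h.norm_sq_gradient.integrable
  have iG' : ∀ {ψ : 𝔼 → ℝ}, IsTestFunction ψ →
      Integrable fun x => ‖‖x‖ ^ (1 + α) • gradient ψ x‖ ^ 2 :=
    fun h => (h.memLp_norm_rpow_smul_gradient hn (by linarith)).norm.integrable_sq
  have mG : ∀ k, MemLp (fun x => w x • gradient (φ k) x) 2 := fun k => by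
    have hm : AEStronglyMeasurable (fun x => w x • gradient (φ k) x) :=
      hwm.aestronglyMeasurable.smul (hφ k).continuous_gradient.aestronglyMeasurable
    rw [memLp_two_iff_integrable_sq_norm hm]
    simp_rw [hwsq]
    exact (iG (hφ k)).add (iG' (hφ k))
  obtain ⟨g, hg, hgt⟩ := exists_memLp_two_limit mG fun ε hε => by
    set C := ((n : ℝ) + 4 * α + 2) / 2 with hC
    have hC0 : 0 < C := by rw [hC]; linarith
    -- The unweighted part costs C⁻¹ times the squared norm and the weighted part costs it once.
    obtain ⟨N, hN⟩ := hc' (ε / (1 + C⁻¹)) (by positivity)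
    refine ⟨N, fun j hj k hk => ?_⟩
    have ht := (hφ j).sub (hφ k)
    simp_rw [← smul_sub, ← (hφ j).gradient_sub (hφ k), hwsq]
    rw [integral_add (iG ht) (iG' ht)]
    have b1 := ht.integral_norm_sq_gradient_le hn h₁ h₂
    have b2 : ∫ x, ‖‖x‖ ^ (1 + α) • gradient (φ j - φ k) x‖ ^ 2 ≤
        H2norm α (-2 - 2 * α) (φ j - φ k) ^ 2 := by
      rw [IsTestFunction.H2norm_sq]
      exact le_add_of_nonneg_left (integral_nonneg fun x => by positivity)
    have b3 := hN j hj k hk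
    rw [lt_div_iff₀ (by positivity)] at b3
    rw [← hC, ← le_div_iff₀' hC0, div_eq_mul_inv] at b1
    linarith
  have hwg : ∀ (x v : 𝔼), w x • (v - (w x)⁻¹ • g x) = w x • v - g x := fun x v => by
    rw [smul_sub, smul_inv_smul₀ (by linarith [hw x])]
  have hGm : AEStronglyMeasurable (fun x => (w x)⁻¹ • g x) volume :=
    hwm.inv.aestronglyMeasurable.smul hg.1
  have hwx : ∀ (x v : 𝔼), ‖v‖ ≤ ‖w x • v‖ := fun x v =>
    le_of_sq_le_sq (by rw [hwsq]; nlinarith [sq_nonneg ‖‖x‖ ^ (1 + α) • v‖]) (norm_nonneg _)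
  have hwx' : ∀ (x v : 𝔼), ‖‖x‖ ^ (1 + α) • v‖ ≤ ‖w x • v‖ := fun x v =>
    le_of_sq_le_sq (by rw [hwsq]; nlinarith [sq_nonneg ‖v‖]) (norm_nonneg _)
  have hwG : ∀ x, w x • (w x)⁻¹ • g x = g x := fun x => smul_inv_smul₀ (by linarith [hw x]) _
  -- The limits g and l are those of w∇φ and |x|^{-α}Δφ, so the weights are undone.
  refine ⟨fun x => (w x)⁻¹ • g x, fun x => ‖x‖ ^ α • l x, φ, hloc, hφ, hK,
    hg.of_le hGm (ae_of_all _ fun x => ?_), hg.of_le ?_ (ae_of_all _ fun x => ?_), ?_, ?_, ?_, ?_⟩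
  · simpa only [hwG] using hwx x ((w x)⁻¹ • g x)
  · exact (by fun_prop : Measurable fun x : 𝔼 => ‖x‖ ^ (1 + α)).aestronglyMeasurable.smul hGm
  · simpa only [hwG] using hwx' x ((w x)⁻¹ • g x)
  · refine hl.ae_eq ((ae_norm_pos hn).mono fun x hx => ?_)
    simp only [smul_smul, ← Real.rpow_add hx]
    simp
  · refine tendsto_integral_of_norm_le (fun k x => by positivity) (fun k x => ?_)
      (fun k => ((mG k).sub hg).norm.integrable_sq) hgt
    simp only [Pi.sub_apply, ← hwg]
    gcongr
    exact hwx _ _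
  · refine tendsto_integral_of_norm_le (fun k x => by positivity) (fun k x => ?_)
      (fun k => ((mG k).sub hg).norm.integrable_sq) hgt
    simp only [Pi.sub_apply, ← hwg]
    gcongr
    exact hwx' _ _
  · refine hlt.congr fun k => integral_congr_ae ((ae_norm_pos hn).mono fun x hx => ?_)
    simp only [smul_sub, smul_smul, ← Real.rpow_add hx]
    simp

namespace ApproximatedBy

variable {α : ℝ} {u : EuclideanSpace ℝ (Fin n) → ℝ}
  {G : EuclideanSpace ℝ (Fin n) → EuclideanSpace ℝ (Fin n)}
  {L : EuclideanSpace ℝ (Fin n) → ℝ} {φ : ℕ → EuclideanSpace ℝ (Fin n) → ℝ}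

theorem memH2 (hn : 1 ≤ n) (h₁ : 0 < (n : ℝ) - 2 * α) (h₂ : 0 < (n : ℝ) + 2 * α)
    (h : ApproximatedBy α u G L φ) : MemH2 α (-2 - 2 * α) u := by
  refine ⟨h.locallyIntegrable, φ, h.test, fun ε hε => ?_, h.tendsto_loc⟩
  obtain ⟨N₁, hN₁⟩ := exists_integral_norm_sub_sq_lt
    (fun k => (h.test k).memLp_norm_rpow_smul_laplacian hn (p := -α) (by linarith))
    h.memLp_laplacian (by simpa only [smul_sub] using h.tendsto_laplacian)
    (ε ^ 2 / 2) (by positivity)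
  obtain ⟨N₂, hN₂⟩ := exists_integral_norm_sub_sq_lt
    (fun k => (h.test k).memLp_norm_rpow_smul_gradient hn (p := 1 + α) (by linarith))
    h.memLp_weighted_grad (by simpa only [smul_sub] using h.tendsto_weighted_grad)
    (ε ^ 2 / 2) (by positivity)
  refine ⟨max N₁ N₂, fun j hj k hk => ?_⟩
  refine lt_of_pow_lt_pow_left₀ 2 hε.le ?_
  rw [IsTestFunction.H2norm_sq]
  simp_rw [(h.test j).laplacian_sub (h.test k), (h.test j).gradient_sub (h.test k), smul_sub]
  linarith [hN₁ j (le_of_max_le_left hj) k (le_of_max_le_left hk),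
    hN₂ j (le_of_max_le_right hj) k (le_of_max_le_right hk)]

theorem isWeakGradient (hn : 1 ≤ n) (h : ApproximatedBy α u G L φ) : IsWeakGradient u G := by
  have hG : LocallyIntegrable G := h.memLp_grad.locallyIntegrable (by norm_num)
  refine ⟨h.locallyIntegrable, hG, fun ψ hψ v => ?_⟩
  have hv : IsTestFunction fun x => inner ℝ (gradient ψ x) v := by
    simp_rw [inner_gradient_left]
    exact ⟨(hψ.1.fderiv_right (m := ∞) (by norm_num)).clm_apply contDiff_const,
      hψ.2.fderiv_apply (𝕜 := ℝ) _⟩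
  have hcont : Continuous fun y : 𝔼 => inner ℝ y v := by fun_prop
  have t1 := tendsto_integral_mul_of_tendsto_setIntegral
    (fun k => (h.test k).continuous.locallyIntegrable) h.locallyIntegrable hv.continuous hv.2
    h.tendsto_loc
  have t2 : Tendsto (fun k => ∫ x, inner ℝ (gradient (φ k) x) v * ψ x) atTop
      (𝓝 (∫ x, inner ℝ (G x) v * ψ x)) := by
    refine tendsto_integral_mul_of_tendsto_setIntegral
      (fun k => (hcont.comp (h.test k).continuous_gradient).locallyIntegrable) ?_
      hψ.continuous hψ.2 fun K hK => ?_
    · refine (locallyIntegrable_iff).2 fun K hK => ?_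
      exact (hG.integrableOn_isCompact hK).inner_const v
    -- Exponent zero is essential: for the exponent 1+α local integrability would need n-2-2α > 0,
    -- which is not assumed.
    · have t3 := tendsto_setIntegral_norm_sub hn (p := 0) (by simp; omega)
        (f := fun k => gradient (φ k)) (g := G)
        (fun k => by simpa using (h.test k).memLp_gradient hn) (by simpa using h.memLp_grad)
        (by simpa using h.tendsto_grad) hK
      refine squeeze_zero (fun k => integral_nonneg fun x => norm_nonneg _) (fun k => ?_)
        (by simpa using t3.mul_const ‖v‖)
      rw [← integral_mul_const]
      refine integral_mono_of_nonneg (ae_of_all _ fun x => norm_nonneg _) ?_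
        (ae_of_all _ fun x => ?_)
      · exact (((h.test k).continuous_gradient.locallyIntegrable.sub hG).integrableOn_isCompact
          hK).norm.mul_const _
      · simp only [← inner_sub_left]
        exact norm_inner_le_norm _ _
  refine tendsto_nhds_unique t1 ?_
  simp_rw [(h.test _).integral_mul_fderiv hψ v]
  exact t2.neg

/-- Green's identity passes to the limit. Convergence of the Laplacians in L¹_loc follows from the
exponent -α, for which the requirement is n+2α > 0. -/
theorem isWeakLaplacian (hn : 1 ≤ n) (h₁ : 0 < (n : ℝ) - 2 * α) (h₂ : 0 < (n : ℝ) + 2 * α)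
    (h : ApproximatedBy α u G L φ) : IsWeakLaplacian u L := by
  have hL : LocallyIntegrable L := locallyIntegrable_iff.2 fun K hK =>
    (integrableOn_of_memLp_norm_rpow_smul hn (by linarith) h.memLp_laplacian hK).1
  refine ⟨h.locallyIntegrable, hL, fun ψ hψ => ?_⟩
  have t1 := tendsto_integral_mul_of_tendsto_setIntegral
    (fun k => (h.test k).continuous.locallyIntegrable) h.locallyIntegrable
    hψ.laplacian.continuous hψ.laplacian.2 h.tendsto_loc
  have t2 := tendsto_integral_mul_of_tendsto_setIntegral
    (fun k => (h.test k).laplacian.continuous.locallyIntegrable) hL hψ.continuous hψ.2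
    fun K hK => tendsto_setIntegral_norm_sub hn (by linarith)
      (fun k => (h.test k).memLp_norm_rpow_smul_laplacian hn (by linarith))
      h.memLp_laplacian h.tendsto_laplacian hK
  refine tendsto_nhds_unique t1 ?_
  simp_rw [(h.test _).integral_mul_laplacian_comm hψ]
  exact t2

theorem integrable_laplacian (h : ApproximatedBy α u G L φ) :
    Integrable fun x => L x ^ 2 * ‖x‖ ^ (-2 * α) := by
  have := h.memLp_laplacian.norm.integrable_sq
  simp_rw [smul_eq_mul, norm_rpow_mul_sq, show 2 * -α = -2 * α by ring] at this
  exact this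

/-- Makes the radial term inherit integrability and convergence from the weighted gradient. -/
theorem norm_rpow_mul_inner_le (hn : 1 ≤ n) (α : ℝ) :
    ∀ᵐ x : 𝔼, ∀ v : 𝔼, ‖‖x‖ ^ α * inner ℝ v x‖ ≤ ‖‖x‖ ^ (1 + α) • v‖ := by
  refine (ae_norm_pos hn).mono fun x hx v => ?_
  rw [norm_mul, norm_smul, Real.rpow_add hx, Real.rpow_one, norm_mul, norm_norm,
    mul_comm ‖x‖, mul_assoc, mul_comm ‖x‖]
  gcongr
  exact norm_inner_le_norm _ _

theorem memLp_inner (hn : 1 ≤ n) {G : 𝔼 → 𝔼} (hG : AEStronglyMeasurable G)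
    (h : MemLp (fun x => ‖x‖ ^ (1 + α) • G x) 2) :
    MemLp (fun x => ‖x‖ ^ α * inner ℝ (G x) x) 2 := by
  refine h.of_le (AEStronglyMeasurable.mul (by fun_prop : Measurable fun x : 𝔼 =>
    ‖x‖ ^ α).aestronglyMeasurable (hG.inner aestronglyMeasurable_id)) ?_
  exact (norm_rpow_mul_inner_le hn α).mono fun x hx => hx (G x)

theorem integrable_inner (hn : 1 ≤ n) (h : ApproximatedBy α u G L φ) :
    Integrable fun x => ‖x‖ ^ (2 * α) * inner ℝ (G x) x ^ 2 := by
  have := (memLp_inner hn h.memLp_grad.1 h.memLp_weighted_grad).norm.integrable_sq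
  simp_rw [norm_rpow_mul_sq] at this
  simp_rw [mul_comm (‖_‖ ^ (2 * α))]
  exact this

/-- Each integral is a squared L² norm of a convergent sequence, so the inequality for the φ k
passes to the limit. -/
theorem le_integral_mul_integral (hn : 1 ≤ n) (h₁ : 0 < (n : ℝ) - 2 * α)
    (h₂ : 0 < (n : ℝ) + 2 * α) (h : ApproximatedBy α u G L φ) :
    (((n : ℝ) + 4 * α + 2) / 2) ^ 2 * (∫ x, ‖G x‖ ^ 2) ^ 2 ≤
      (∫ x, L x ^ 2 * ‖x‖ ^ (-2 * α)) * ∫ x, ‖x‖ ^ (2 * α) * inner ℝ (G x) x ^ 2 := by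
  have tD := tendsto_integral_norm_sq (fun k => (h.test k).memLp_gradient hn) h.memLp_grad
    h.tendsto_grad
  have tA := tendsto_integral_norm_sq
    (fun k => (h.test k).memLp_norm_rpow_smul_laplacian hn (p := -α) (by linarith))
    h.memLp_laplacian (by simpa only [smul_sub] using h.tendsto_laplacian)
  have mG : ∀ k, MemLp (fun x => ‖x‖ ^ (1 + α) • gradient (φ k) x) 2 := fun k =>
    (h.test k).memLp_norm_rpow_smul_gradient hn (by linarith)
  have tB := tendsto_integral_norm_sq
    (fun k => memLp_inner hn (h.test k).continuous_gradient.aestronglyMeasurable (mG k))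
    (memLp_inner hn h.memLp_grad.1 h.memLp_weighted_grad) (by
      refine squeeze_zero (fun k => integral_nonneg fun x => by positivity) (fun k => ?_)
        h.tendsto_weighted_grad
      refine integral_mono_of_nonneg (ae_of_all _ fun x => by positivity) ?_
        ((norm_rpow_mul_inner_le hn α).mono fun x hx => ?_)
      · simp only [smul_sub]
        exact ((mG k).sub h.memLp_weighted_grad).norm.integrable_sq
      · simp only [← mul_sub, ← inner_sub_left]
        gcongr
        exact hx _)
  simp_rw [smul_eq_mul, norm_rpow_mul_sq, show 2 * -α = -2 * α by ring] at tA
  simp_rw [norm_rpow_mul_sq, inner_gradient_left] at tB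
  simp_rw [mul_comm (‖_‖ ^ (2 * α))]
  exact le_of_tendsto_of_tendsto' ((tD.pow 2).const_mul _) (tA.mul tB) fun k =>
    (h.test k).caffarelli_kohn_nirenberg hn h₁ h₂

end ApproximatedBy

/-! ### Uniqueness of weak derivatives -/

theorem IsWeakGradient.ae_eq {u : 𝔼 → ℝ} {G G' : 𝔼 → 𝔼} (h : IsWeakGradient u G)
    (h' : IsWeakGradient u G') : G =ᵐ[volume] G' := by
  refine ae_eq_of_integral_contDiff_smul_eq h.2.1 h'.2.1 fun ψ hψ hs => ?_
  refine ext_inner_right ℝ fun v => ?_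
  have hi : ∀ {F : 𝔼 → 𝔼}, LocallyIntegrable F →
      inner ℝ (∫ x, ψ x • F x) v = ∫ x, inner ℝ (F x) v * ψ x := fun hF => by
    rw [real_inner_comm, ← integral_inner
      (hF.integrable_smul_left_of_hasCompactSupport hψ.continuous hs)]
    simp_rw [inner_smul_right, real_inner_comm v, mul_comm]
  rw [hi h.2.1, hi h'.2.1]
  linarith [h.2.2 ψ ⟨hψ, hs⟩ v, h'.2.2 ψ ⟨hψ, hs⟩ v]

theorem IsWeakLaplacian.ae_eq {u L L' : 𝔼 → ℝ} (h : IsWeakLaplacian u L)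
    (h' : IsWeakLaplacian u L') : L =ᵐ[volume] L' := by
  refine ae_eq_of_integral_contDiff_smul_eq h.2.1 h'.2.1 fun ψ hψ hs => ?_
  simp_rw [smul_eq_mul, mul_comm (ψ _)]
  rw [← h.2.2 ψ ⟨hψ, hs⟩, ← h'.2.2 ψ ⟨hψ, hs⟩]

end Completion

/-! ### Radial functions -/

section RadialFunctions

variable {n : ℕ}

local notation "𝔼" => EuclideanSpace ℝ (Fin n)

/-- Radial functions are written in |x|² rather than |x| because |x|² is smooth at the origin. -/
theorem hasFDerivAt_comp_norm_sq {P : ℝ → ℝ} {P' : ℝ} {x : 𝔼} (hP : HasDerivAt P P' (‖x‖ ^ 2)) :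
    HasFDerivAt (fun y : 𝔼 => P (‖y‖ ^ 2)) ((2 * P') • innerSL ℝ x) x := by
  have h := hP.comp_hasFDerivAt x (hasStrictFDerivAt_norm_sq x).hasFDerivAt
  refine h.congr_fderiv ?_
  ext v
  simp
  ring

theorem gradient_comp_norm_sq {P : ℝ → ℝ} {P' : ℝ} {x : 𝔼} (hP : HasDerivAt P P' (‖x‖ ^ 2)) :
    gradient (fun y : 𝔼 => P (‖y‖ ^ 2)) x = (2 * P') • x := by
  refine ext_inner_right ℝ fun v => ?_
  rw [inner_gradient_left, (hasFDerivAt_comp_norm_sq hP).fderiv]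
  simp [inner_smul_left]

theorem laplacian_comp_norm_sq {P P' P'' : ℝ → ℝ} (hP : ∀ s, 0 ≤ s → HasDerivAt P (P' s) s)
    (hP' : ∀ s, 0 ≤ s → HasDerivAt P' (P'' s) s)
    (hc : ContDiff ℝ 2 fun y : 𝔼 => P (‖y‖ ^ 2)) (x : 𝔼) :
    Laplacian.laplacian (fun y : 𝔼 => P (‖y‖ ^ 2)) x =
      2 * n * P' (‖x‖ ^ 2) + 4 * ‖x‖ ^ 2 * P'' (‖x‖ ^ 2) := by
  rw [laplacian_eq_sum_partialDeriv hc]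
  have h1 : ∀ i, partialDeriv i (fun y : 𝔼 => P (‖y‖ ^ 2)) =
      fun y : 𝔼 => 2 * (P' (‖y‖ ^ 2) * y i) := fun i => by
    funext y
    rw [partialDeriv, (hasFDerivAt_comp_norm_sq (hP _ (sq_nonneg _))).fderiv]
    simp [mul_assoc, EuclideanSpace.inner_single_right]
  have h2 : ∀ i, partialDeriv i (fun y : 𝔼 => 2 * (P' (‖y‖ ^ 2) * y i)) x =
      2 * P' (‖x‖ ^ 2) + 4 * P'' (‖x‖ ^ 2) * x i ^ 2 := fun i => by
    have h3 := hasFDerivAt_comp_norm_sq (hP' _ (sq_nonneg ‖x‖))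
    have h4 : HasFDerivAt (fun y : 𝔼 => y i) (EuclideanSpace.proj i : 𝔼 →L[ℝ] ℝ) x :=
      (EuclideanSpace.proj i : 𝔼 →L[ℝ] ℝ).hasFDerivAt
    rw [partialDeriv, ((h3.fun_mul h4).const_mul 2).fderiv]
    simp [EuclideanSpace.inner_single_right]
    ring
  simp_rw [h1, h2]
  have h3 : ∑ i, x i ^ 2 = ‖x‖ ^ 2 := by simp [EuclideanSpace.norm_sq_eq]
  rw [Finset.sum_add_distrib, ← Finset.mul_sum, ← Finset.mul_sum, h3]
  simp
  ring

end RadialFunctions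

section Dominated

/-- Dominated convergence in `L²`. -/
theorem memLp_two_and_tendsto_of_dominated {X F : Type*} [MeasurableSpace X] {μ : Measure X}
    [NormedAddCommGroup F] {f : ℕ → X → F} {g : X → F} {B : X → ℝ}
    (hf : ∀ k, AEStronglyMeasurable (f k) μ) (hB : Integrable B μ)
    (hle : ∀ k, ∀ᵐ x ∂μ, ‖f k x‖ ^ 2 ≤ B x)
    (hlim : ∀ᵐ x ∂μ, Tendsto (fun k => f k x) atTop (𝓝 (g x))) :
    MemLp g 2 μ ∧ Tendsto (fun k => ∫ x, ‖f k x - g x‖ ^ 2 ∂μ) atTop (𝓝 0) := by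
  have hg : AEStronglyMeasurable g μ := aestronglyMeasurable_of_tendsto_ae atTop hf hlim
  have hgB : ∀ᵐ x ∂μ, ‖g x‖ ^ 2 ≤ B x := by
    filter_upwards [ae_all_iff.2 hle, hlim] with x hx hx'
    exact le_of_tendsto' (hx'.norm.pow 2) hx
  refine ⟨(memLp_two_iff_integrable_sq_norm hg).2 (hB.mono' (hg.norm.pow 2) ?_), ?_⟩
  · exact hgB.mono fun x hx => by simpa using hx
  · have := tendsto_integral_of_dominated_convergence (f := fun _ => (0 : ℝ)) (μ := μ)
      -- The factor 4 comes from |f-g|² ≤ 2|f|² + 2|g|².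
      (F := fun k x => ‖f k x - g x‖ ^ 2) (fun x => 4 * B x)
      (fun k => ((hf k).sub hg).norm.pow 2) (hB.const_mul 4) (fun k => ?_) ?_
    · simpa using this
    · filter_upwards [hle k, hgB] with x h1 h2
      rw [Real.norm_of_nonneg (by positivity)]
      have h3 := norm_sub_le (f k x) (g x)
      nlinarith [norm_nonneg (f k x - g x), sq_nonneg (‖f k x‖ - ‖g x‖)]
    · filter_upwards [hlim] with x hx
      simpa using ((hx.sub_const (g x)).norm.pow 2)

end Dominated

/-! ### The regularised extremal profile -/

section Profile

/-- `U₀` as a function of `|x|²`. -/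
noncomputable def profile (α t : ℝ) : ℝ := Real.exp (-(t ^ (1 + α) / (2 * (1 + α))))

/-- The derivative of `profile`. -/
noncomputable def profileDeriv (α t : ℝ) : ℝ := -(1 / 2) * t ^ α * profile α t

/-- The second derivative of `profile`. -/
noncomputable def profileDerivTwo (α t : ℝ) : ℝ :=
  (-(α / 2) * t ^ (α - 1) + 1 / 4 * (t ^ α) ^ 2) * profile α t

variable {α : ℝ}

theorem profile_pos (t : ℝ) : 0 < profile α t := Real.exp_pos _

theorem hasDerivAt_profile (hα : 0 < 1 + α) {t : ℝ} (ht : 0 < t) :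
    HasDerivAt (profile α) (profileDeriv α t) t := by
  have h := ((Real.hasDerivAt_rpow_const (x := t) (p := 1 + α) (Or.inl ht.ne')).div_const
    (2 * (1 + α))).fun_neg.exp
  refine h.congr_deriv ?_
  rw [profileDeriv, profile, show 1 + α - 1 = α by ring]
  field_simp

theorem hasDerivAt_profileDeriv (hα : 0 < 1 + α) {t : ℝ} (ht : 0 < t) :
    HasDerivAt (profileDeriv α) (profileDerivTwo α t) t := by
  have h := ((Real.hasDerivAt_rpow_const (x := t) (p := α) (Or.inl ht.ne')).const_mul
    (-(1 / 2))).mul (hasDerivAt_profile hα ht)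
  refine h.congr_deriv ?_
  rw [profileDerivTwo, profileDeriv]
  ring

theorem continuousAt_profileDerivTwo (hα : 0 < 1 + α) {t : ℝ} (ht : 0 < t) :
    ContinuousAt (profileDerivTwo α) t := by
  have h := (hasDerivAt_profile hα ht).continuousAt
  have h1 := Real.continuousAt_rpow_const t (α - 1) (Or.inl ht.ne')
  have h2 := Real.continuousAt_rpow_const t α (Or.inl ht.ne')
  unfold profileDerivTwo
  exact ((h1.const_mul _).add ((h2.pow 2).const_mul _)).mul h

/-- Controls the shifted power (s+ε)^α uniformly in ε ≤ 1. For α ≥ 0 either t ≤ 2 or t ≤ 2s; for α ≤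
0 the power decreases. The summand 1 is needed when α > 0 and s is near 0. -/
theorem rpow_le_of_le_add_one {s t : ℝ} (α : ℝ) (hs : 0 < s) (hst : s ≤ t) (ht : t ≤ s + 1) :
    t ^ α ≤ 2 ^ |α| * (1 + s ^ α) := by
  have hs' := Real.rpow_pos_of_pos hs α
  rcases le_total 0 α with h | h
  · rw [abs_of_nonneg h]
    rcases le_total s 1 with h1 | h1
    · calc t ^ α ≤ 2 ^ α := Real.rpow_le_rpow (by linarith) (by linarith) h
        _ ≤ _ := le_mul_of_one_le_right (by positivity) (by linarith)
    · calc t ^ α ≤ (2 * s) ^ α := Real.rpow_le_rpow (by linarith) (by linarith) h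
        _ = 2 ^ α * s ^ α := Real.mul_rpow (by norm_num) hs.le
        _ ≤ _ := by gcongr; linarith
  · calc t ^ α ≤ s ^ α := Real.rpow_le_rpow_of_nonpos hs hst h
      _ ≤ 1 * (1 + s ^ α) := by linarith
      _ ≤ _ := by
        gcongr
        exact Real.one_le_rpow (by norm_num) (abs_nonneg _)

theorem profile_anti (hα : 0 < 1 + α) {s t : ℝ} (hs : 0 ≤ s) (hst : s ≤ t) :
    profile α t ≤ profile α s := by
  unfold profile
  gcongr

theorem abs_profileDeriv_le (hα : 0 < 1 + α) {s t : ℝ} (hs : 0 < s) (hst : s ≤ t)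
    (ht : t ≤ s + 1) :
    |profileDeriv α t| ≤ 2 ^ |α| * (1 + s ^ α) * profile α s := by
  have h1 := rpow_le_of_le_add_one α hs hst ht
  have h2 := profile_anti hα hs.le hst
  have h3 := profile_pos (α := α) t
  have h4 : 0 ≤ t ^ α := Real.rpow_nonneg (hs.le.trans hst) _
  rw [profileDeriv, abs_mul, abs_mul, abs_of_nonneg h4, abs_of_pos h3]
  norm_num
  calc 1 / 2 * t ^ α * profile α t ≤ t ^ α * profile α t := by
        gcongr
        linarith
    _ ≤ _ := by gcongr

/-- The factor s, which is the one the radial Laplacian provides, absorbs the singular power: s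
t^{α-1} ≤ t^α for s ≤ t. -/
theorem abs_profileDerivTwo_le (hα : 0 < 1 + α) {s t : ℝ} (hs : 0 < s) (hst : s ≤ t)
    (ht : t ≤ s + 1) :
    s * |profileDerivTwo α t| ≤ (|α| * 2 ^ |α| * (1 + s ^ α) +
      s * (2 ^ |α| * (1 + s ^ α)) ^ 2) * profile α s := by
  have h1 := rpow_le_of_le_add_one α hs hst ht
  have h2 := profile_anti hα hs.le hst
  have h3 := profile_pos (α := α) t
  have ht0 : 0 < t := hs.trans_le hst
  have h4 : 0 < t ^ α := Real.rpow_pos_of_pos ht0 _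
  have h5 : s * t ^ (α - 1) ≤ t ^ α := by
    rw [Real.rpow_sub_one ht0.ne', ← mul_div_assoc, div_le_iff₀ ht0, mul_comm]
    gcongr
  have h6 : 0 < t ^ (α - 1) := Real.rpow_pos_of_pos ht0 _
  have h7 : |-(α / 2) * t ^ (α - 1) + 1 / 4 * (t ^ α) ^ 2| ≤
      |α| * t ^ (α - 1) + (t ^ α) ^ 2 := by
    refine (abs_add_le _ _).trans ?_
    rw [abs_mul, abs_neg, abs_div, abs_of_pos h6, abs_of_nonneg (by positivity : 0 ≤ 1 / 4 * (t ^ α) ^ 2),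
      abs_two]
    have : 0 ≤ |α| * t ^ (α - 1) := by positivity
    nlinarith [sq_nonneg (t ^ α)]
  rw [profileDerivTwo, abs_mul, abs_of_pos h3]
  calc s * (|-(α / 2) * t ^ (α - 1) + 1 / 4 * (t ^ α) ^ 2| * profile α t)
      ≤ s * ((|α| * t ^ (α - 1) + (t ^ α) ^ 2) * profile α t) := by gcongr
    _ = (|α| * (s * t ^ (α - 1)) + s * (t ^ α) ^ 2) * profile α t := by ring
    _ ≤ (|α| * (2 ^ |α| * (1 + s ^ α)) + s * (2 ^ |α| * (1 + s ^ α)) ^ 2) * profile α s := by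
      refine mul_le_mul (add_le_add ?_ ?_) h2 h3.le (by positivity)
      · exact mul_le_mul_of_nonneg_left (h5.trans h1) (abs_nonneg _)
      · gcongr
    _ = _ := by ring

/-! ### Shift and truncation of the profile -/

/-- A smooth function on `ℝ` with compact support, equal to one near the origin. -/
noncomputable def cutoff : ContDiffBump (0 : ℝ) := ⟨1, 2, one_pos, one_lt_two⟩

theorem contDiff_cutoff : ContDiff ℝ ∞ cutoff := cutoff.contDiff

theorem contDiff_deriv_cutoff : ContDiff ℝ ∞ (deriv cutoff) :=
  ((contDiff_infty_iff_deriv).1 contDiff_cutoff).2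

theorem contDiff_deriv_deriv_cutoff : ContDiff ℝ ∞ (deriv (deriv cutoff)) :=
  ((contDiff_infty_iff_deriv).1 contDiff_deriv_cutoff).2

theorem exists_cutoff_bound : ∃ M : ℝ, 1 ≤ M ∧ (∀ y, |cutoff y| ≤ M) ∧ (∀ y, |deriv cutoff y| ≤ M) ∧
    ∀ y, |deriv (deriv cutoff) y| ≤ M := by
  have hs : HasCompactSupport cutoff := cutoff.hasCompactSupport
  obtain ⟨M₀, h₀⟩ := contDiff_cutoff.continuous.bounded_above_of_compact_support hs
  obtain ⟨M₁, h₁⟩ := contDiff_deriv_cutoff.continuous.bounded_above_of_compact_support hs.deriv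
  obtain ⟨M₂, h₂⟩ :=
    contDiff_deriv_deriv_cutoff.continuous.bounded_above_of_compact_support hs.deriv.deriv
  refine ⟨max (max 1 M₀) (max M₁ M₂), by simp, fun y => (h₀ y).trans (by simp),
    fun y => (h₁ y).trans (by simp), fun y => (h₂ y).trans (by simp)⟩

/-- The regularised and truncated profile. -/
noncomputable def regProfile (α ε s : ℝ) : ℝ := profile α (s + ε) * cutoff (ε * s)

/-- The derivative of `regProfile` in `s`. -/
noncomputable def regProfileDeriv (α ε s : ℝ) : ℝ :=
  profileDeriv α (s + ε) * cutoff (ε * s) + profile α (s + ε) * (ε * deriv cutoff (ε * s))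

/-- The second derivative of `regProfile` in `s`. -/
noncomputable def regProfileDerivTwo (α ε s : ℝ) : ℝ :=
  profileDerivTwo α (s + ε) * cutoff (ε * s) +
    2 * (profileDeriv α (s + ε) * (ε * deriv cutoff (ε * s))) +
    profile α (s + ε) * (ε ^ 2 * deriv (deriv cutoff) (ε * s))

theorem hasDerivAt_comp_const_mul {g : ℝ → ℝ} (hg : ContDiff ℝ ∞ g) (ε s : ℝ) :
    HasDerivAt (fun s => g (ε * s)) (ε * deriv g (ε * s)) s := by
  have h := (hg.differentiable (by simp) (ε * s)).hasDerivAt.comp s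
    ((hasDerivAt_id s).const_mul ε)
  simpa [mul_comm, Function.comp_def] using h

/-- The shift keeps s+ε positive, so the formula holds at s = 0 too, that is, at the origin of ℝⁿ.
-/
theorem hasDerivAt_regProfile (hα : 0 < 1 + α) {ε s : ℝ} (hε : 0 < ε) (hs : 0 ≤ s) :
    HasDerivAt (regProfile α ε) (regProfileDeriv α ε s) s :=
  ((hasDerivAt_profile hα (add_pos_of_nonneg_of_pos hs hε)).comp_add_const s ε).mul
    (hasDerivAt_comp_const_mul contDiff_cutoff ε s)

theorem hasDerivAt_regProfileDeriv (hα : 0 < 1 + α) {ε s : ℝ} (hε : 0 < ε) (hs : 0 ≤ s) :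
    HasDerivAt (regProfileDeriv α ε) (regProfileDerivTwo α ε s) s := by
  have ht := add_pos_of_nonneg_of_pos hs hε
  have h := (((hasDerivAt_profileDeriv hα ht).comp_add_const s ε).mul
    (hasDerivAt_comp_const_mul contDiff_cutoff ε s)).add
    (((hasDerivAt_profile hα ht).comp_add_const s ε).mul
      ((hasDerivAt_comp_const_mul contDiff_deriv_cutoff ε s).const_mul ε))
  refine h.congr_deriv ?_
  rw [regProfileDerivTwo]
  ring

/-- The constant is independent of ε, as domination requires. Derivatives of the cutoff bring only
factors ε ≤ 1. -/
theorem abs_regProfileDeriv_le (hα : 0 < 1 + α) : ∃ C, 0 ≤ C ∧ ∀ ε s : ℝ, 0 < ε → ε ≤ 1 → 0 < s →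
    |regProfileDeriv α ε s| ≤ C * ((1 + s ^ α) * profile α s) := by
  obtain ⟨M, hM1, hM, hM', -⟩ := exists_cutoff_bound
  refine ⟨2 ^ |α| * M + M, by positivity, fun ε s hε hε1 hs => ?_⟩
  have h1 := abs_profileDeriv_le hα hs (t := s + ε) (by linarith) (by linarith)
  have h2 := profile_anti hα hs.le (t := s + ε) (by linarith)
  have h3 := profile_pos (α := α) s
  have h4 := profile_pos (α := α) (s + ε)
  have h5 : 0 ≤ s ^ α := Real.rpow_nonneg hs.le _
  calc |regProfileDeriv α ε s|
      ≤ |profileDeriv α (s + ε)| * |cutoff (ε * s)| +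
        profile α (s + ε) * (ε * |deriv cutoff (ε * s)|) := by
        refine (abs_add_le _ _).trans ?_
        rw [abs_mul, abs_mul, abs_mul, abs_of_pos h4, abs_of_pos hε]
    _ ≤ 2 ^ |α| * (1 + s ^ α) * profile α s * M + (1 + s ^ α) * profile α s * (1 * M) := by
        gcongr
        · exact hM _
        · nlinarith
        · exact hM' _
    _ = _ := by ring

theorem abs_regProfileDerivTwo_le (hα : 0 < 1 + α) : ∃ C, 0 ≤ C ∧ ∀ ε s : ℝ, 0 < ε → ε ≤ 1 →
    0 < s → s * |regProfileDerivTwo α ε s| ≤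
      C * (((1 + s ^ α) + s * (1 + s ^ α) ^ 2) * profile α s) := by
  obtain ⟨M, hM1, hM, hM', hM''⟩ := exists_cutoff_bound
  set K : ℝ := 2 ^ |α| with hK
  have hK0 : 0 < K := by positivity
  refine ⟨(|α| * K + K ^ 2) * M + 2 * (K * M) + M, by positivity, fun ε s hε hε1 hs => ?_⟩
  have h0 := abs_profileDerivTwo_le hα hs (t := s + ε) (by linarith) (by linarith)
  have h1 := abs_profileDeriv_le hα hs (t := s + ε) (by linarith) (by linarith)
  have h2 := profile_anti hα hs.le (t := s + ε) (by linarith)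
  have h3 := profile_pos (α := α) s
  have h4 := profile_pos (α := α) (s + ε)
  have h5 : 0 ≤ s ^ α := Real.rpow_nonneg hs.le _
  rw [← hK] at h0 h1
  set a := 1 + s ^ α with ha
  have ha1 : 1 ≤ a := by linarith
  have ha2 : a ≤ a ^ 2 := by nlinarith
  have haa : 1 ≤ a ^ 2 := ha1.trans ha2
  set p := profile α s
  calc s * |regProfileDerivTwo α ε s|
      ≤ s * (|profileDerivTwo α (s + ε)| * |cutoff (ε * s)| +
        2 * (|profileDeriv α (s + ε)| * (ε * |deriv cutoff (ε * s)|)) +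
        profile α (s + ε) * (ε ^ 2 * |deriv (deriv cutoff) (ε * s)|)) := by
        gcongr
        refine (abs_add_le _ _).trans (add_le_add ((abs_add_le _ _).trans (le_of_eq ?_))
          (le_of_eq ?_))
        · simp only [abs_mul, abs_of_pos hε, abs_two]
        · simp only [abs_mul, abs_of_pos h4, abs_pow, abs_of_pos hε]
    _ = (s * |profileDerivTwo α (s + ε)|) * |cutoff (ε * s)| +
        2 * (s * (|profileDeriv α (s + ε)| * (ε * |deriv cutoff (ε * s)|))) +
        s * (profile α (s + ε) * (ε ^ 2 * |deriv (deriv cutoff) (ε * s)|)) := by ring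
    _ ≤ (|α| * K * a + s * (K * a) ^ 2) * p * M + 2 * (s * (K * a ^ 2 * p * (1 * M))) +
        s * (a ^ 2 * p * (1 ^ 2 * M)) := by
        gcongr
        · exact hM _
        · exact h1.trans (by gcongr)
        · exact hM' _
        · nlinarith
        · exact hM'' _
    _ ≤ _ := by
        have e1 : 0 ≤ s * a ^ 2 * p := by positivity
        have e2 : 0 ≤ a * p := by positivity
        have e3 : 0 ≤ |α| * K * M * (s * a ^ 2 * p) := by positivity
        have e4 : 0 ≤ (K ^ 2 * M + 2 * (K * M) + M) * (a * p) := by positivity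
        nlinarith

theorem cutoff_zero : cutoff (0 : ℝ) = 1 :=
  cutoff.one_of_mem_closedBall (by simp [cutoff])

theorem tendsto_const_add_zero (s : ℝ) : Tendsto (fun ε : ℝ => s + ε) (𝓝 0) (𝓝 s) := by
  simpa using (tendsto_const_nhds (x := s)).add (tendsto_id (α := ℝ) (x := 𝓝 0))

theorem tendsto_mul_const_zero (s : ℝ) : Tendsto (fun ε : ℝ => ε * s) (𝓝 0) (𝓝 0) := by
  simpa using (tendsto_id (α := ℝ) (x := 𝓝 0)).mul_const s

theorem tendsto_regProfileDeriv (hα : 0 < 1 + α) {s : ℝ} (hs : 0 < s) :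
    Tendsto (fun ε => regProfileDeriv α ε s) (𝓝 0) (𝓝 (profileDeriv α s)) := by
  have hadd := tendsto_const_add_zero s
  have hmul := tendsto_mul_const_zero s
  have t0 := (hasDerivAt_profile hα hs).continuousAt.tendsto.comp hadd
  have t1 := (hasDerivAt_profileDeriv hα hs).continuousAt.tendsto.comp hadd
  have c0 := contDiff_cutoff.continuous.tendsto 0 |>.comp hmul
  have c1 := contDiff_deriv_cutoff.continuous.tendsto 0 |>.comp hmul
  have := (t1.mul c0).add (t0.mul (tendsto_id.mul c1))
  simpa [cutoff_zero, regProfileDeriv] using this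

theorem tendsto_regProfileDerivTwo (hα : 0 < 1 + α) {s : ℝ} (hs : 0 < s) :
    Tendsto (fun ε => regProfileDerivTwo α ε s) (𝓝 0) (𝓝 (profileDerivTwo α s)) := by
  have hadd := tendsto_const_add_zero s
  have hmul := tendsto_mul_const_zero s
  have t0 := (hasDerivAt_profile hα hs).continuousAt.tendsto.comp hadd
  have t1 := (hasDerivAt_profileDeriv hα hs).continuousAt.tendsto.comp hadd
  have t2 := (continuousAt_profileDerivTwo hα hs).tendsto.comp hadd
  have c0 := contDiff_cutoff.continuous.tendsto 0 |>.comp hmul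
  have c1 := contDiff_deriv_cutoff.continuous.tendsto 0 |>.comp hmul
  have c2 := contDiff_deriv_deriv_cutoff.continuous.tendsto 0 |>.comp hmul
  have := ((t2.mul c0).add ((t1.mul (tendsto_id.mul c1)).const_mul 2)).add
    (t0.mul ((tendsto_id.pow 2).mul c2))
  simpa [cutoff_zero, regProfileDerivTwo] using this

theorem tendsto_regProfile (hα : 0 < 1 + α) {s : ℝ} (hs : 0 < s) :
    Tendsto (fun ε => regProfile α ε s) (𝓝 0) (𝓝 (profile α s)) := by
  have hadd := tendsto_const_add_zero s
  have hmul := tendsto_mul_const_zero s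
  have := ((hasDerivAt_profile hα hs).continuousAt.tendsto.comp hadd).mul
    (contDiff_cutoff.continuous.tendsto 0 |>.comp hmul)
  simpa [cutoff_zero, regProfile] using this

theorem abs_regProfile_le : ∃ M, ∀ ε s : ℝ, 0 < ε → 0 ≤ s → 0 < 1 + α →
    |regProfile α ε s| ≤ M := by
  obtain ⟨M, hM1, hM, -⟩ := exists_cutoff_bound
  refine ⟨M, fun ε s hε hs hα => ?_⟩
  rw [regProfile, abs_mul, abs_of_pos (profile_pos _)]
  have : profile α (s + ε) ≤ 1 := by
    rw [profile, Real.exp_le_one_iff, neg_nonpos]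
    positivity
  calc _ ≤ 1 * M := by
        gcongr
        exact hM _
    _ = M := one_mul M

end Profile

/-! ### The extremal function -/

section Extremal

variable {n : ℕ} {α : ℝ}

local notation "𝔼" => EuclideanSpace ℝ (Fin n)

/-- The radial integrand `|x|^p U₀(x)²`. -/
noncomputable def radialWeight (n : ℕ) (α p : ℝ) (x : EuclideanSpace ℝ (Fin n)) : ℝ :=
  ‖x‖ ^ p * Real.exp (-(1 + α)⁻¹ * ‖x‖ ^ (2 * (1 + α)))

theorem integrable_radialWeight (hn : 1 ≤ n) (hα : 0 < 1 + α) {p : ℝ} (hp : 0 < n + p) :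
    Integrable (radialWeight n α p) :=
  integrable_norm_rpow_mul_exp hn hp (by positivity) (by positivity)

theorem integral_radialWeight_pos (hn : 1 ≤ n) (hα : 0 < 1 + α) {p : ℝ} (hp : 0 < n + p) :
    0 < ∫ x, radialWeight n α p x :=
  integral_norm_rpow_mul_exp_pos hn hp (by positivity) (by positivity)

theorem integral_radialWeight_add (hn : 1 ≤ n) (hα : 0 < 1 + α) {p : ℝ} (hp : 0 < n + p) :
    2 * ∫ x, radialWeight n α (p + 2 * (1 + α)) x = (n + p) * ∫ x, radialWeight n α p x := by
  have h := integral_norm_rpow_add_mul_exp hn (q := 2 * (1 + α)) (b := (1 + α)⁻¹) hp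
    (by positivity) (by positivity)
  rwa [show (1 + α)⁻¹ * (2 * (1 + α)) = 2 by field_simp] at h

theorem profile_norm_sq (α : ℝ) (x : 𝔼) : profile α (‖x‖ ^ 2) = U₀ n α x := by
  rw [profile, U₀, ← Real.rpow_natCast_mul (norm_nonneg x)]
  norm_num

theorem profile_norm_sq_sq (hα : 0 < 1 + α) (x : 𝔼) :
    profile α (‖x‖ ^ 2) ^ 2 = Real.exp (-(1 + α)⁻¹ * ‖x‖ ^ (2 * (1 + α))) := by
  rw [profile_norm_sq, U₀, ← Real.exp_nat_mul]
  congr 1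
  push_cast
  field_simp

/-- Splitting of the exponent in `radialWeight`. -/
theorem radialWeight_eq (hα : 0 < 1 + α) {x : 𝔼} (hx : 0 < ‖x‖) (p : ℝ) (i j : ℕ) :
    radialWeight n α (p + (i + j * (2 * α))) x =
      ‖x‖ ^ p * (‖x‖ ^ i * ((‖x‖ ^ 2) ^ α) ^ j) * profile α (‖x‖ ^ 2) ^ 2 := by
  rw [radialWeight, profile_norm_sq_sq hα, Real.rpow_add hx, Real.rpow_add hx, Real.rpow_natCast,
    mul_comm (j : ℝ), Real.rpow_mul_natCast hx.le, Real.rpow_mul hx.le, Real.rpow_two]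

/-- Smooth compactly supported approximations of `U₀`. -/
noncomputable def approxU₀ (n : ℕ) (α : ℝ) (k : ℕ) (x : EuclideanSpace ℝ (Fin n)) : ℝ :=
  regProfile α (1 / ((k : ℝ) + 1)) (‖x‖ ^ 2)

/-- The gradient of `U₀` away from the origin. -/
noncomputable def gradU₀ (n : ℕ) (α : ℝ) (x : EuclideanSpace ℝ (Fin n)) :
    EuclideanSpace ℝ (Fin n) := (2 * profileDeriv α (‖x‖ ^ 2)) • x

/-- The Laplacian of `U₀` away from the origin. -/
noncomputable def laplacianU₀ (n : ℕ) (α : ℝ) (x : EuclideanSpace ℝ (Fin n)) : ℝ :=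
  2 * n * profileDeriv α (‖x‖ ^ 2) + 4 * ‖x‖ ^ 2 * profileDerivTwo α (‖x‖ ^ 2)

theorem one_div_add_one_mem (k : ℕ) : 0 < 1 / ((k : ℝ) + 1) ∧ 1 / ((k : ℝ) + 1) ≤ 1 :=
  ⟨by positivity, by rw [div_le_one (by positivity)]; linarith [k.cast_nonneg (α := ℝ)]⟩

theorem isTestFunction_approxU₀ (k : ℕ) : IsTestFunction (approxU₀ n α k) := by
  have hε := (one_div_add_one_mem k).1
  set ε := 1 / ((k : ℝ) + 1) with hεdef
  have hsq : ContDiff ℝ ∞ fun x : 𝔼 => ‖x‖ ^ 2 := contDiff_norm_sq ℝ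
  constructor
  · have h1 : ContDiff ℝ ∞ fun x : 𝔼 => (‖x‖ ^ 2 + ε) ^ (1 + α) :=
      (hsq.add contDiff_const).rpow_const_of_ne fun x => by positivity
    have h2 : ContDiff ℝ ∞ fun x : 𝔼 => cutoff (ε * ‖x‖ ^ 2) :=
      contDiff_cutoff.comp (contDiff_const.mul hsq)
    exact (h1.div_const _).neg.exp.mul h2
  · refine HasCompactSupport.intro (isCompact_closedBall (0 : 𝔼) √(2 / ε)) fun x hx => ?_
    have h1 : √(2 / ε) < ‖x‖ := by simpa using hx
    have h2 : 2 < ε * ‖x‖ ^ 2 := by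
      have := (Real.sqrt_lt' ((Real.sqrt_nonneg _).trans_lt h1)).1 h1
      rwa [div_lt_iff₀ hε, mul_comm] at this
    have h3 : cutoff (ε * ‖x‖ ^ 2) = 0 := cutoff.zero_of_le_dist (by
      rw [dist_zero_right, Real.norm_of_nonneg (by positivity)]
      exact h2.le)
    simp only [approxU₀, regProfile, ← hεdef, h3, mul_zero]

theorem gradient_approxU₀ (hα : 0 < 1 + α) (k : ℕ) (x : 𝔼) : gradient (approxU₀ n α k) x =
    (2 * regProfileDeriv α (1 / ((k : ℝ) + 1)) (‖x‖ ^ 2)) • x :=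
  gradient_comp_norm_sq (hasDerivAt_regProfile hα (one_div_add_one_mem k).1 (sq_nonneg _))

theorem laplacian_approxU₀ (hα : 0 < 1 + α) (k : ℕ) (x : 𝔼) :
    Laplacian.laplacian (approxU₀ n α k) x =
      2 * n * regProfileDeriv α (1 / ((k : ℝ) + 1)) (‖x‖ ^ 2) +
        4 * ‖x‖ ^ 2 * regProfileDerivTwo α (1 / ((k : ℝ) + 1)) (‖x‖ ^ 2) :=
  laplacian_comp_norm_sq (fun _ hs => hasDerivAt_regProfile hα (one_div_add_one_mem k).1 hs)
    (fun _ hs => hasDerivAt_regProfileDeriv hα (one_div_add_one_mem k).1 hs)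
    ((isTestFunction_approxU₀ k).of_le 2) x

/-- The majorant is a sum of |x|^{2p+2}U₀² and |x|^{2p+2+4α}U₀²; the two hypotheses on p are their
integrability at the origin. -/
theorem exists_gradient_approxU₀_le (hn : 1 ≤ n) (hα : 0 < 1 + α) (p : ℝ) (hp : 0 < n + 2 + 2 * p)
    (hp' : 0 < n + 2 + 4 * α + 2 * p) : ∃ B : 𝔼 → ℝ, Integrable B ∧
      ∀ k, ∀ᵐ x, ‖‖x‖ ^ p • gradient (approxU₀ n α k) x‖ ^ 2 ≤ B x := by
  obtain ⟨C, hC0, hC⟩ := abs_regProfileDeriv_le hα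
  refine ⟨fun x => 8 * C ^ 2 * (radialWeight n α (2 * p + ((2 : ℕ) + (0 : ℕ) * (2 * α))) x +
    radialWeight n α (2 * p + ((2 : ℕ) + (2 : ℕ) * (2 * α))) x), ?_, fun k => ?_⟩
  · refine ((integrable_radialWeight hn hα ?_).add (integrable_radialWeight hn hα ?_)).const_mul _
    · push_cast
      linarith
    · push_cast
      linarith
  · refine (ae_norm_pos hn).mono fun x hx => ?_
    have h := hC _ _ (one_div_add_one_mem k).1 (one_div_add_one_mem k).2 (pow_pos hx 2)
    beta_reduce
    rw [norm_rpow_smul_sq, gradient_approxU₀ hα, radialWeight_eq hα hx, radialWeight_eq hα hx,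
      norm_smul, Real.norm_eq_abs, abs_mul, abs_two]
    have hy : 0 ≤ (‖x‖ ^ 2) ^ α := by positivity
    have hw : 0 ≤ ‖x‖ ^ (2 * p) := by positivity
    have hP := profile_pos (α := α) (‖x‖ ^ 2)
    set y := (‖x‖ ^ 2) ^ α
    set w := ‖x‖ ^ (2 * p)
    set P := profile α (‖x‖ ^ 2)
    calc _ ≤ (2 * (C * ((1 + y) * P)) * ‖x‖) ^ 2 * w := by gcongr
      _ = (1 + y) ^ 2 * (4 * C ^ 2 * ‖x‖ ^ 2 * P ^ 2 * w) := by ring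
      _ ≤ (2 * (1 + y ^ 2)) * (4 * C ^ 2 * ‖x‖ ^ 2 * P ^ 2 * w) := by
        gcongr
        nlinarith [sq_nonneg (1 - y)]
      _ = _ := by ring

/-- The majorant has the exponents -2α, 2α, 4-2α and 4+6α. The first two are integrable at the
origin by n-2α > 0 and n+2α > 0; the others then follow from 1+α > 0. -/
theorem exists_laplacian_approxU₀_le (hn : 1 ≤ n) (hα : 0 < 1 + α) (h₁ : 0 < (n : ℝ) - 2 * α)
    (h₂ : 0 < (n : ℝ) + 2 * α) : ∃ B : 𝔼 → ℝ, Integrable B ∧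
      ∀ k, ∀ᵐ x, ‖‖x‖ ^ (-α) • Laplacian.laplacian (approxU₀ n α k) x‖ ^ 2 ≤ B x := by
  obtain ⟨C₁, hC₁0, hC₁⟩ := abs_regProfileDeriv_le hα
  obtain ⟨C₂, hC₂0, hC₂⟩ := abs_regProfileDerivTwo_le hα
  set C := 2 * n * C₁ + 4 * C₂ with hC
  refine ⟨fun x => C ^ 2 * ((4 * radialWeight n α (2 * -α + ((0 : ℕ) + (0 : ℕ) * (2 * α))) x +
    4 * radialWeight n α (2 * -α + ((0 : ℕ) + (2 : ℕ) * (2 * α))) x) +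
    (16 * radialWeight n α (2 * -α + ((4 : ℕ) + (0 : ℕ) * (2 * α))) x +
    16 * radialWeight n α (2 * -α + ((4 : ℕ) + (4 : ℕ) * (2 * α))) x)), ?_, fun k => ?_⟩
  · refine ((((integrable_radialWeight hn hα ?_).const_mul 4).add
      ((integrable_radialWeight hn hα ?_).const_mul 4)).add
      (((integrable_radialWeight hn hα ?_).const_mul 16).add
      ((integrable_radialWeight hn hα ?_).const_mul 16))).const_mul _ <;> push_cast <;> linarith
  · refine (ae_norm_pos hn).mono fun x hx => ?_
    have h := hC₁ _ _ (one_div_add_one_mem k).1 (one_div_add_one_mem k).2 (pow_pos hx 2)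
    have h' := hC₂ _ _ (one_div_add_one_mem k).1 (one_div_add_one_mem k).2 (pow_pos hx 2)
    beta_reduce
    rw [norm_rpow_smul_sq, laplacian_approxU₀ hα, radialWeight_eq hα hx, radialWeight_eq hα hx,
      radialWeight_eq hα hx, radialWeight_eq hα hx, Real.norm_eq_abs]
    have hy : 0 ≤ (‖x‖ ^ 2) ^ α := by positivity
    have hw : 0 ≤ ‖x‖ ^ (2 * -α) := by positivity
    have hP := profile_pos (α := α) (‖x‖ ^ 2)
    have hs : 0 < ‖x‖ ^ 2 := by positivity
    rw [show ‖x‖ ^ 4 = (‖x‖ ^ 2) ^ 2 by ring]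
    set s := ‖x‖ ^ 2
    set y := s ^ α
    set w := ‖x‖ ^ (2 * -α)
    set P := profile α s
    set d₁ := regProfileDeriv α (1 / ((k : ℝ) + 1)) s
    set d₂ := regProfileDerivTwo α (1 / ((k : ℝ) + 1)) s
    have hQ : |2 * n * d₁ + 4 * s * d₂| ≤ C * (((1 + y) + s * (1 + y) ^ 2) * P) := by
      calc |2 * n * d₁ + 4 * s * d₂| ≤ 2 * n * |d₁| + 4 * (s * |d₂|) := by
            refine (abs_add_le _ _).trans (le_of_eq ?_)
            rw [abs_mul, abs_mul, abs_mul, abs_mul, abs_two, abs_of_pos hs, Nat.abs_cast,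
              abs_of_pos (by norm_num : (0 : ℝ) < 4)]
            ring
        _ ≤ 2 * n * (C₁ * (((1 + y) + s * (1 + y) ^ 2) * P)) +
            4 * (C₂ * (((1 + y) + s * (1 + y) ^ 2) * P)) := by
            refine add_le_add ?_ (by gcongr)
            refine mul_le_mul_of_nonneg_left (h.trans ?_) (by positivity)
            refine mul_le_mul_of_nonneg_left (mul_le_mul_of_nonneg_right ?_ hP.le) hC₁0
            exact le_add_of_nonneg_right (by positivity)
        _ = _ := by rw [hC]; ring
    have hQ2 : ((1 + y) + s * (1 + y) ^ 2) ^ 2 ≤ 4 + 4 * y ^ 2 + 16 * s ^ 2 + 16 * s ^ 2 * y ^ 4 := by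
      have e1 : (1 + y) ^ 2 ≤ 2 * (1 + y ^ 2) := by nlinarith [sq_nonneg (1 - y)]
      have e2 : ((1 + y) ^ 2) ^ 2 ≤ 8 * (1 + y ^ 4) := by
        calc ((1 + y) ^ 2) ^ 2 ≤ (2 * (1 + y ^ 2)) ^ 2 := by gcongr
          _ ≤ 8 * (1 + y ^ 4) := by nlinarith [sq_nonneg (1 - y ^ 2)]
      have e3 := mul_le_mul_of_nonneg_left e2 (sq_nonneg s)
      nlinarith [sq_nonneg ((1 + y) - s * (1 + y) ^ 2)]
    calc _ ≤ (C * (((1 + y) + s * (1 + y) ^ 2) * P)) ^ 2 * w := by gcongr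
      _ = ((1 + y) + s * (1 + y) ^ 2) ^ 2 * (C ^ 2 * P ^ 2 * w) := by ring
      _ ≤ (4 + 4 * y ^ 2 + 16 * s ^ 2 + 16 * s ^ 2 * y ^ 4) * (C ^ 2 * P ^ 2 * w) := by gcongr
      _ = _ := by ring

theorem continuous_U₀ (hα : 0 < 1 + α) : Continuous (U₀ n α) := by
  have : Continuous fun x : 𝔼 => ‖x‖ ^ (2 * (1 + α)) :=
    continuous_norm.rpow_const fun x => Or.inr (by positivity)
  unfold U₀
  fun_prop

theorem approximatedBy_U₀ (hn : 1 ≤ n) (hα : 0 < 1 + α) (h₁ : 0 < (n : ℝ) - 2 * α)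
    (h₂ : 0 < (n : ℝ) + 2 * α) :
    ApproximatedBy α (U₀ n α) (gradU₀ n α) (laplacianU₀ n α) (approxU₀ n α) := by
  have hε : Tendsto (fun k : ℕ => 1 / ((k : ℝ) + 1)) atTop (𝓝 0) :=
    tendsto_one_div_add_atTop_nhds_zero_nat
  have htest := isTestFunction_approxU₀ (n := n) (α := α)
  have limG : ∀ p : ℝ, ∀ᵐ x : 𝔼, Tendsto (fun k => ‖x‖ ^ p • gradient (approxU₀ n α k) x) atTop
      (𝓝 (‖x‖ ^ p • gradU₀ n α x)) := fun p => (ae_norm_pos hn).mono fun x hx => by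
    simp_rw [gradient_approxU₀ hα, gradU₀]
    exact ((((tendsto_regProfileDeriv hα (pow_pos hx 2)).comp hε).const_mul 2).smul_const
      x).const_smul _
  have limL : ∀ᵐ x : 𝔼, Tendsto (fun k => ‖x‖ ^ (-α) • Laplacian.laplacian (approxU₀ n α k) x) atTop
      (𝓝 (‖x‖ ^ (-α) • laplacianU₀ n α x)) := (ae_norm_pos hn).mono fun x hx => by
    simp_rw [laplacian_approxU₀ hα, laplacianU₀]
    exact ((((tendsto_regProfileDeriv hα (pow_pos hx 2)).comp hε).const_mul _).add
      (((tendsto_regProfileDerivTwo hα (pow_pos hx 2)).comp hε).const_mul _)).const_smul _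
  have dG : ∀ p : ℝ, 0 < n + 2 + 2 * p → 0 < n + 2 + 4 * α + 2 * p →
      MemLp (fun x => ‖x‖ ^ p • gradU₀ n α x) 2 ∧ Tendsto (fun k => ∫ x,
        ‖‖x‖ ^ p • gradient (approxU₀ n α k) x - ‖x‖ ^ p • gradU₀ n α x‖ ^ 2) atTop (𝓝 0) := by
    intro p hp hp'
    obtain ⟨B, hB, hle⟩ := exists_gradient_approxU₀_le hn hα p hp hp'
    refine memLp_two_and_tendsto_of_dominated (fun k => ?_) hB hle (limG p)
    exact (by fun_prop : Measurable fun x : 𝔼 => ‖x‖ ^ p).aestronglyMeasurable.smul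
      (htest k).continuous_gradient.aestronglyMeasurable
  obtain ⟨B, hB, hle⟩ := exists_laplacian_approxU₀_le hn hα h₁ h₂
  obtain ⟨mL, tL⟩ := memLp_two_and_tendsto_of_dominated
    (f := fun k x => ‖x‖ ^ (-α) • Laplacian.laplacian (approxU₀ n α k) x)
    (fun k => (by fun_prop : Measurable fun x : 𝔼 => ‖x‖ ^ (-α)).aestronglyMeasurable.smul
      (htest k).laplacian.continuous.aestronglyMeasurable) hB hle limL
  -- Here n+2+4α > 0 comes for free, as the sum of n+2α > 0 and 2(1+α) > 0.
  obtain ⟨m0, t0⟩ := dG 0 (by linarith) (by linarith)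
  obtain ⟨m1, t1⟩ := dG (1 + α) (by linarith) (by linarith)
  refine ⟨(continuous_U₀ hα).locallyIntegrable, htest, fun K hK => ?_, by simpa using m0, m1, mL,
    by simpa using t0, by simpa only [smul_sub] using t1, by simpa only [smul_sub] using tL⟩
  obtain ⟨M, hM⟩ := abs_regProfile_le (α := α)
  have hfin : IsFiniteMeasure (volume.restrict K : Measure 𝔼) :=
    ⟨by simpa using hK.measure_lt_top⟩
  have := tendsto_integral_of_dominated_convergence (μ := volume.restrict K) (f := fun _ => (0 : ℝ))
    (F := fun k x => |approxU₀ n α k x - U₀ n α x|) (fun _ => M + 1) (fun k => ?_)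
    (integrable_const _) (fun k => ae_of_all _ fun x => ?_) ?_
  · simpa using this
  · exact ((htest k).continuous.sub (continuous_U₀ hα)).abs.aestronglyMeasurable
  · have hU : |U₀ n α x| ≤ 1 := by
      rw [U₀, abs_of_pos (Real.exp_pos _), Real.exp_le_one_iff, neg_nonpos]
      positivity
    rw [Real.norm_eq_abs, abs_abs]
    exact (abs_sub _ _).trans (add_le_add
      (hM _ _ (one_div_add_one_mem k).1 (sq_nonneg _) hα) hU)
  · refine ae_restrict_of_ae ((ae_norm_pos hn).mono fun x hx => ?_)
    have h := (tendsto_regProfile hα (pow_pos hx 2)).comp hε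
    rw [profile_norm_sq] at h
    simpa [approxU₀] using (h.sub_const (U₀ n α x)).abs

theorem integral_norm_sq_gradU₀ (hn : 1 ≤ n) (hα : 0 < 1 + α) :
    ∫ x, ‖gradU₀ n α x‖ ^ 2 = ∫ x, radialWeight n α (2 + 4 * α) x := by
  refine integral_congr_ae ((ae_norm_pos hn).mono fun x hx => ?_)
  have h := radialWeight_eq hα hx 0 2 2
  rw [show (0 : ℝ) + ((2 : ℕ) + (2 : ℕ) * (2 * α)) = 2 + 4 * α by push_cast; ring] at h
  beta_reduce
  rw [h, gradU₀, profileDeriv, norm_smul, mul_pow, Real.norm_eq_abs, sq_abs, Real.rpow_zero]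
  ring

theorem integral_inner_gradU₀ (hn : 1 ≤ n) (hα : 0 < 1 + α) :
    ∫ x, ‖x‖ ^ (2 * α) * inner ℝ (gradU₀ n α x) x ^ 2 = ∫ x, radialWeight n α (4 + 6 * α) x := by
  refine integral_congr_ae ((ae_norm_pos hn).mono fun x hx => ?_)
  have h := radialWeight_eq hα hx 0 4 3
  rw [show (0 : ℝ) + ((4 : ℕ) + (3 : ℕ) * (2 * α)) = 4 + 6 * α by push_cast; ring] at h
  beta_reduce
  rw [h, gradU₀, profileDeriv, inner_smul_left, real_inner_self_eq_norm_sq, Real.rpow_zero,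
    Real.rpow_mul hx.le, Real.rpow_two]
  simp only [conj_trivial]
  ring

/-- Off the origin ΔU₀ = |x|^{2α}(|x|^{2+2α} - (n+2α))U₀; the three terms are the expanded square.
-/
theorem integral_sq_laplacianU₀ (hn : 1 ≤ n) (hα : 0 < 1 + α) (h₂ : 0 < (n : ℝ) + 2 * α) :
    ∫ x, laplacianU₀ n α x ^ 2 * ‖x‖ ^ (-2 * α) =
      (∫ x, radialWeight n α (4 + 6 * α) x) - 2 * (n + 2 * α) *
        (∫ x, radialWeight n α (2 + 4 * α) x) +
        (n + 2 * α) ^ 2 * ∫ x, radialWeight n α (2 * α) x := by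
  have i1 := integrable_radialWeight hn hα (p := 4 + 6 * α) (by linarith)
  have i2 := integrable_radialWeight hn hα (p := 2 + 4 * α) (by linarith)
  have i3 := integrable_radialWeight hn hα (p := 2 * α) (by linarith)
  have i12 : Integrable fun x => radialWeight n α (4 + 6 * α) x -
      2 * (n + 2 * α) * radialWeight n α (2 + 4 * α) x := i1.sub (i2.const_mul _)
  rw [← integral_const_mul, ← integral_const_mul, ← integral_sub i1 (i2.const_mul _),
    ← integral_add i12 (i3.const_mul _)]
  refine integral_congr_ae ((ae_norm_pos hn).mono fun x hx => ?_)
  have e1 := radialWeight_eq hα hx 0 4 3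
  have e2 := radialWeight_eq hα hx 0 2 2
  have e3 := radialWeight_eq hα hx 0 0 1
  rw [show (0 : ℝ) + ((4 : ℕ) + (3 : ℕ) * (2 * α)) = 4 + 6 * α by push_cast; ring] at e1
  rw [show (0 : ℝ) + ((2 : ℕ) + (2 : ℕ) * (2 * α)) = 2 + 4 * α by push_cast; ring] at e2
  rw [show (0 : ℝ) + ((0 : ℕ) + (1 : ℕ) * (2 * α)) = 2 * α by push_cast; ring] at e3
  have hy := Real.rpow_pos_of_pos (pow_pos hx 2) α
  beta_reduce
  rw [e1, e2, e3, laplacianU₀, profileDeriv, profileDerivTwo, Real.rpow_zero,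
    Real.rpow_sub_one (pow_pos hx 2).ne', show -2 * α = -(2 * α) by ring,
    Real.rpow_neg hx.le, Real.rpow_mul hx.le, Real.rpow_two]
  field_simp
  ring

end Extremal

/-! ### The inequality, its sharpness and the extremal -/

theorem theorem1p1 (n : ℕ) (hn : 1 ≤ n) (α : ℝ)
    (h₁ : 0 < (n : ℝ) - 2 * α) (h₂ : 0 < (n : ℝ) + 2 * α) (h₃ : 0 < (n : ℝ) + 2 + 4 * α) :
    (∀ u : EuclideanSpace ℝ (Fin n) → ℝ, MemH2 α (-2 - 2 * α) u →
      (∃ G, IsWeakGradient u G) ∧ (∃ L, IsWeakLaplacian u L) ∧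
      ∀ G L, IsWeakGradient u G → IsWeakLaplacian u L →
        Integrable (fun x => (L x) ^ 2 * ‖x‖ ^ (-2 * α)) volume ∧
        Integrable (fun x => ‖x‖ ^ (2 * α) * (inner ℝ (G x) x) ^ 2) volume ∧
        Integrable (fun x => ‖G x‖ ^ 2) volume ∧
        (∫ x, (L x) ^ 2 * ‖x‖ ^ (-2 * α)) * (∫ x, ‖x‖ ^ (2 * α) * (inner ℝ (G x) x) ^ 2) ≥
          (((n : ℝ) + 4 * α + 2) / 2) ^ 2 * (∫ x, ‖G x‖ ^ 2) ^ 2) ∧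
    (0 < 1 + α →
      -- the constant is sharp
      (∀ C : ℝ,
        (∀ u : EuclideanSpace ℝ (Fin n) → ℝ, MemH2 α (-2 - 2 * α) u →
          ∀ G L, IsWeakGradient u G → IsWeakLaplacian u L →
            (∫ x, (L x) ^ 2 * ‖x‖ ^ (-2 * α)) * (∫ x, ‖x‖ ^ (2 * α) * (inner ℝ (G x) x) ^ 2) ≥
              C * (∫ x, ‖G x‖ ^ 2) ^ 2) →
        C ≤ (((n : ℝ) + 4 * α + 2) / 2) ^ 2) ∧
      -- and it is attained by `U₀`
      MemH2 α (-2 - 2 * α) (U₀ n α) ∧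
      ∀ G L, IsWeakGradient (U₀ n α) G → IsWeakLaplacian (U₀ n α) L →
        0 < ∫ x, ‖G x‖ ^ 2 ∧
        (∫ x, (L x) ^ 2 * ‖x‖ ^ (-2 * α)) * (∫ x, ‖x‖ ^ (2 * α) * (inner ℝ (G x) x) ^ 2) =
          (((n : ℝ) + 4 * α + 2) / 2) ^ 2 * (∫ x, ‖G x‖ ^ 2) ^ 2) := by
  -- The claims concern arbitrary versions of the weak derivatives, so they are transferred from the
  -- constructed ones by uniqueness.
  have congrs : ∀ {u : EuclideanSpace ℝ (Fin n) → ℝ} {G G' L L'}, IsWeakGradient u G →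
      IsWeakGradient u G' → IsWeakLaplacian u L → IsWeakLaplacian u L' →
      ((fun x => (L x) ^ 2 * ‖x‖ ^ (-2 * α)) =ᵐ[volume] fun x => (L' x) ^ 2 * ‖x‖ ^ (-2 * α)) ∧
      ((fun x => ‖x‖ ^ (2 * α) * (inner ℝ (G x) x) ^ 2) =ᵐ[volume]
        fun x => ‖x‖ ^ (2 * α) * (inner ℝ (G' x) x) ^ 2) ∧
      ((fun x => ‖G x‖ ^ 2) =ᵐ[volume] fun x => ‖G' x‖ ^ 2) := fun hG hG' hL hL' =>
    ⟨(hL.ae_eq hL').mono fun x hx => by simp only [hx],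
      (hG.ae_eq hG').mono fun x hx => by simp only [hx],
      (hG.ae_eq hG').mono fun x hx => by simp only [hx]⟩
  refine ⟨fun u hu => ?_, fun hα => ?_⟩
  · obtain ⟨G, L, φ, h⟩ := hu.exists_approximatedBy hn h₁ h₂ h₃
    have hG := h.isWeakGradient hn
    have hL := h.isWeakLaplacian hn h₁ h₂
    refine ⟨⟨G, hG⟩, ⟨L, hL⟩, fun G' L' hG' hL' => ?_⟩
    obtain ⟨e1, e2, e3⟩ := congrs hG' hG hL' hL
    refine ⟨h.integrable_laplacian.congr e1.symm, (h.integrable_inner hn).congr e2.symm,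
      h.memLp_grad.norm.integrable_sq.congr e3.symm, ?_⟩
    rw [integral_congr_ae e1, integral_congr_ae e2, integral_congr_ae e3]
    exact h.le_integral_mul_integral hn h₁ h₂
  · have h := approximatedBy_U₀ hn hα h₁ h₂
    have hU := h.memH2 hn h₁ h₂
    have hG := h.isWeakGradient hn
    have hL := h.isWeakLaplacian hn h₁ h₂
    have heq : ∀ G L, IsWeakGradient (U₀ n α) G → IsWeakLaplacian (U₀ n α) L →
        0 < ∫ x, ‖G x‖ ^ 2 ∧
        (∫ x, (L x) ^ 2 * ‖x‖ ^ (-2 * α)) * (∫ x, ‖x‖ ^ (2 * α) * (inner ℝ (G x) x) ^ 2) =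
          (((n : ℝ) + 4 * α + 2) / 2) ^ 2 * (∫ x, ‖G x‖ ^ 2) ^ 2 := by
      intro G L hG' hL'
      obtain ⟨e1, e2, e3⟩ := congrs hG' hG hL' hL
      rw [integral_congr_ae e1, integral_congr_ae e2, integral_congr_ae e3,
        integral_norm_sq_gradU₀ hn hα, integral_inner_gradU₀ hn hα,
        integral_sq_laplacianU₀ hn hα h₂]
      -- `r1` makes the last two terms of the Laplacian integral cancel, so it equals the radial
      -- integral. By `r2` that common value is (n+4α+2)/2 times the gradient integral.
      have r1 := integral_radialWeight_add hn hα (p := 2 * α) h₂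
      have r2 := integral_radialWeight_add hn hα (p := 2 + 4 * α) (by linarith)
      rw [show 2 * α + 2 * (1 + α) = 2 + 4 * α by ring] at r1
      rw [show 2 + 4 * α + 2 * (1 + α) = 4 + 6 * α by ring] at r2
      refine ⟨integral_radialWeight_pos hn hα (by linarith), ?_⟩
      have r3 : (∫ x, radialWeight n α (4 + 6 * α) x) =
          ((n : ℝ) + 4 * α + 2) / 2 * ∫ x, radialWeight n α (2 + 4 * α) x := by linarith
      rw [sq ((n : ℝ) + 2 * α), mul_assoc ((n : ℝ) + 2 * α), ← r1, r3]
      ring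
    refine ⟨fun C hC => ?_, hU, heq⟩
    -- Sharpness follows from attainment: the inequality with C, tested on U₀, is divided by the
    -- positive square of the gradient integral.
    obtain ⟨hpos, he⟩ := heq _ _ hG hL
    have hle := hC _ hU _ _ hG hL
    rw [he] at hle
    exact le_of_mul_le_mul_right hle (by positivity)
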